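/- Let $G$ be a (Hausdorff) locally compact Abelian group, $\mathcal C(G)$ the space of continuous complex functions on $G$ with uniform convergence on compact sets, and $\mathcal M_c(G)$ its dual, the convolution algebra of compactly supported complex Radon measures, with the weak*-topology. An exponential is a continuous homomorphism $m:G\to\mathbb C\setminus\{0\}$; write $\check m(x)=m(-x)$ and $\widehat\mu(m)=\int \check m\,d\mu$. The Fourier algebra $\mathcal A(G)=\{\widehat\mu:\mu\in\mathcal M_c(G)\}$ carries the pointwise operations and the topology transported from $\mathcal M_c(G)$ by the bijection $\mu\mapsto\widehat\mu$. Derivations of order $0$ on $\mathcal A(G)$ are the constant multiples of the identity; a derivation of order $1$ is a continuous linear operator $D$ on $\mathcal A(G)$ with $D(ab)=D(a)b+aD(b)$; a continuous linear operator $D$ is a derivation of order $n+1$ ($n\ge1$) if $(a,b)\mapsto D(ab)-D(a)b-aD(b)$ is a derivation of order $n$ in each variable. A derivation is a derivation of some order. The polynomial derivations are the elements of the algebra $\mathcal P(G)$ of operators generated by the identity and all derivations of order $1$. The generating function of $D$ at $m$ is $f_{D,m}(x)=D(\widehat\delta_x)(m)\,m(x)$. With $\Delta_{y}*f(x)=f(x+y)-f(x)$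 and $\Delta_{y_1,\dots,y_k}*f=\Delta_{y_1}*\cdots*\Delta_{y_k}*f$, let $\widehat I_{D,m}$ be the set of all $\widehat\mu$ with $$D(\widehat\mu)(m)=\widehat\mu(m)=\int[\Delta_{x,y_1,\dots,y_k}*f_{D,m}](0)\,\check m(x)\,d\mu(x)=0\qquad (k\ge 1,\ y_1,\dots,y_k\in G).$$ An ideal $\widehat I$ of $\mathcal A(G)$ is non-localizable if there is a $\widehat\nu\notin\widehat I$ such that $D(\widehat\nu)(m)=0$ for every $m$ in $Z(\widehat I)=\{m:\widehat\mu(m)=0\text{ for all }\widehat\mu\in\widehat I\}$ and every $D\in\mathcal P(G)$ with $D(\widehat\mu)(m)=0$ for all $\widehat\mu\in\widehat I$. A variety is a closed translation invariant linear subspace of $\mathcal C(G)$; it is synthesizable if its finite dimensional subvarieties span a dense subspace of it. Put $\mathrm{Ann}\,I=\{f\in\mathcal C(G):\mu*f=0\text{ whenever }\widehat\mu\in\widehat I\}$. **Proposition.** Let $D$ be a non-polynomial derivation on $\mathcal A(G)$ (that is, $D\notin\mathcal P(G)$) and $m$ an exponential. Assume that the generating function $f_{D,m'}$ does not depend on the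 exponential $m'$ or, alternatively, that $D$ is non-polynomial at $m$, i.e. there is no $E\in\mathcal P(G)$ with $E(\widehat\mu)(m)=D(\widehat\mu)(m)$ for all $\widehat\mu\in\mathcal A(G)$. Then $\widehat I_{D,m}$ is a closed ideal of $\mathcal A(G)$ and it is non-localizable. Moreover $V=\mathrm{Ann}\,I_{D,m}$ is a variety, $\widehat I_{D,m}$ is its annihilator (that is, $\widehat\mu\in\widehat I_{D,m}$ if and only if $\mu*f=0$ for all $f\in V$), and $V$ is not synthesizable. -/

import Mathlib

namespace SpectralSynthesis

noncomputable section

variable {G : Type*} [AddCommGroup G] [TopologicalSpace G]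

/-- The measure algebra `M_c(G)`: compactly supported complex (Radon) measures on `G`, identified
with the topological dual of `C(G)` (the continuous complex functions on `G`, with uniform
convergence on compact sets), and equipped with the weak-* topology.
For `μ : MeasureAlgebra G` and `f : C(G, ℂ)` the number `μ f` is `∫ f dμ`. -/
abbrev MeasureAlgebra (G : Type*) [TopologicalSpace G] : Type _ := WeakDual ℂ C(G, ℂ)

theorem continuous_integral {G : Type*} [TopologicalSpace G] (μ : MeasureAlgebra G) :
    Continuous fun f : C(G, ℂ) => μ f :=
  ContinuousLinearMap.continuous (show C(G, ℂ) →L[ℂ] ℂ from μ)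

/-- The exponentials of `G`: the continuous homomorphisms of `G` into the multiplicative group of
nonzero complex numbers. -/
abbrev Exponential (G : Type*) [AddCommGroup G] [TopologicalSpace G] : Type _ :=
  {m : AddChar G ℂ // Continuous m}

section

variable [IsTopologicalAddGroup G]

/-- The function `x ↦ m (-x)`. -/
def Exponential.check (m : Exponential G) : C(G, ℂ) :=
  ⟨fun x => m.1 (-x), m.2.comp continuous_neg⟩

/-- The point mass `δ_x`. -/
def dirac {G : Type*} [TopologicalSpace G] (x : G) : MeasureAlgebra G := ContinuousMap.evalCLM ℂ x

/-- The Fourier--Laplace transform `m ↦ ∫ m(-x) dμ(x)`, as a function on the exponentials. -/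
def transformFun : MeasureAlgebra G →ₗ[ℂ] (Exponential G → ℂ) where
  toFun μ m := μ m.check
  map_add' _ _ := rfl
  map_smul' _ _ := rfl

/-- The continuous function `(x, y) ↦ f (x + y)`, curried: `y ↦ (x ↦ f (x + y))`. -/
def shifts (f : C(G, ℂ)) : C(G, C(G, ℂ)) :=
  (f.comp ⟨fun p : G × G => p.2 + p.1, by fun_prop⟩).curry

/-- `y ↦ ∫ f (x + y) dμ(x)`. -/
def innerIntegral (μ : MeasureAlgebra G) (f : C(G, ℂ)) : C(G, ℂ) :=
  ⟨fun y => μ (shifts f y), (continuous_integral μ).comp (shifts f).continuous⟩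

variable [LocallyCompactSpace G]

/-- Convolution of measures: `⟨μ * ν, f⟩ = ∫ ∫ f (x + y) dμ(x) dν(y)`. -/
def conv (μ ν : MeasureAlgebra G) : MeasureAlgebra G :=
  { toFun := fun f => ν (innerIntegral μ f)
    map_add' := fun f g => by
      have : innerIntegral μ (f + g) = innerIntegral μ f + innerIntegral μ g := by
        ext y; exact map_add μ (shifts f y) (shifts g y)
      rw [this, map_add]
    map_smul' := fun c f => by
      have : innerIntegral μ (c • f) = c • innerIntegral μ f := by
        ext y; exact map_smul μ c (shifts f y)
      rw [this, map_smul]; rfl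
    cont := by
      have h1 : Continuous fun f : C(G, ℂ) => shifts f :=
        ContinuousMap.continuous_curry.comp (ContinuousMap.continuous_precomp _)
      have h2 : Continuous fun f : C(G, ℂ) => innerIntegral μ f :=
        (ContinuousMap.continuous_postcomp (⟨fun g => μ g,
          (continuous_integral μ)⟩ : C(C(G, ℂ), ℂ))).comp h1
      exact (continuous_integral ν).comp h2 }

theorem transformFun_conv (μ ν : MeasureAlgebra G) :
    transformFun (conv μ ν) = transformFun μ * transformFun ν := by
  funext m
  have h : innerIntegral μ m.check = (μ m.check) • m.check := by
    ext y
    have : shifts m.check y = m.1 (-y) • m.check := by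
      ext x
      change m.1 (-(x + y)) = m.1 (-y) * m.1 (-x)
      rw [← AddChar.map_add_eq_mul, neg_add_rev]
    change μ (shifts m.check y) = μ m.check * m.1 (-y)
    rw [this, map_smul, smul_eq_mul, mul_comm]
  change ν (innerIntegral μ m.check) = μ m.check * ν m.check
  rw [h, map_smul, smul_eq_mul]

variable (G) in
/-- The set of all Fourier--Laplace transforms of measures in `M_c(G)`, an algebra of functions on
the exponentials under the pointwise operations. -/
def fourierSubalgebra : Subalgebra ℂ (Exponential G → ℂ) where
  carrier := Set.range (transformFun (G := G))
  add_mem' := by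
    rintro _ _ ⟨μ, rfl⟩ ⟨ν, rfl⟩
    exact ⟨μ + ν, map_add _ _ _⟩
  mul_mem' := by
    rintro _ _ ⟨μ, rfl⟩ ⟨ν, rfl⟩
    exact ⟨conv μ ν, transformFun_conv μ ν⟩
  algebraMap_mem' c := by
    refine ⟨c • dirac (0 : G), ?_⟩
    funext m
    change c * m.1 (-0) = c
    simp

variable (G) in
/-- The Fourier algebra `A(G)`. -/
def FourierAlgebra : Type _ := fourierSubalgebra G

instance : CommRing (FourierAlgebra G) := inferInstanceAs (CommRing (fourierSubalgebra G))

instance : Algebra ℂ (FourierAlgebra G) := inferInstanceAs (Algebra ℂ (fourierSubalgebra G))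

/-- Elements of the Fourier algebra are functions on the exponentials. -/
instance : CoeFun (FourierAlgebra G) fun _ => Exponential G → ℂ := ⟨fun a => a.1⟩

/-- The transform `μ ↦ μ̂`, from the measure algebra onto the Fourier algebra. -/
def transform : MeasureAlgebra G →ₗ[ℂ] FourierAlgebra G :=
  (transformFun (G := G)).codRestrict (Subalgebra.toSubmodule (fourierSubalgebra G))
    fun μ => ⟨μ, rfl⟩

/-- The topology of `A(G)` is the one of the measure algebra, carried over by the transform (which
is a bijection). -/
instance : TopologicalSpace (FourierAlgebra G) :=
  TopologicalSpace.coinduced (transform (G := G)) inferInstance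

/-! ### Derivations -/

/-- The bilinear operator `(a, b) ↦ D (a * b) - D a * b - a * D b`, as an operator in `a` for
fixed `b`. It is symmetric in `a` and `b`. -/
def leibnizDefect (D : FourierAlgebra G →ₗ[ℂ] FourierAlgebra G) (b : FourierAlgebra G) :
    FourierAlgebra G →ₗ[ℂ] FourierAlgebra G :=
  D ∘ₗ LinearMap.mulRight ℂ b - LinearMap.mulRight ℂ b ∘ₗ D - LinearMap.mulRight ℂ (D b)

/-- Derivations of order (at most) `n`. The zero operator is admitted; as the operator
`leibnizDefect` is symmetric, it suffices to consider one of its two variables. -/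
def IsDerivationOfOrder : ℕ → (FourierAlgebra G →ₗ[ℂ] FourierAlgebra G) → Prop
  | 0, D => ∃ c : ℂ, D = c • LinearMap.id
  | 1, D => Continuous D ∧ ∀ a b, D (a * b) = D a * b + a * D b
  | n + 2, D => Continuous D ∧ ∀ b, IsDerivationOfOrder (n + 1) (leibnizDefect D b)

/-- Derivations (of any order). -/
def IsDerivation (D : FourierAlgebra G →ₗ[ℂ] FourierAlgebra G) : Prop :=
  ∃ n, IsDerivationOfOrder n D

variable (G) in
/-- The algebra `P(G)` of polynomial derivations: the algebra of operators (under composition)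
generated by the identity and all derivations of first order. -/
def polynomialDerivations : Subalgebra ℂ (Module.End ℂ (FourierAlgebra G)) :=
  Algebra.adjoin ℂ {D | IsDerivationOfOrder 1 D}

theorem continuous_dirac {G : Type*} [TopologicalSpace G] : Continuous fun x : G => dirac x :=
  WeakDual.continuous_of_continuous_eval fun f => f.continuous

theorem continuous_eval (m : Exponential G) : Continuous fun a : FourierAlgebra G => a m :=
  continuous_coinduced_dom.2 (WeakDual.eval_continuous m.check)

/-- The generating function `x ↦ D(δ̂_x)(m) m(x)` of the continuous linear operator `D`. -/
def generatingFunction (D : FourierAlgebra G →L[ℂ] FourierAlgebra G) (m : Exponential G) :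
    C(G, ℂ) where
  toFun x := D (transform (dirac x)) m * m.1 x
  continuous_toFun := by
    refine Continuous.mul ?_ m.2
    exact (continuous_eval m).comp (D.continuous.comp
      (continuous_coinduced_rng.comp continuous_dirac))

/-- The iterated difference `Δ_{y₁,…,y_k} * f`, where `(Δ_y * f)(x) = f (x + y) - f x`. -/
def iterDiff {G : Type*} [AddCommGroup G] (ys : List G) (f : G → ℂ) : G → ℂ := ys.foldr (fun y g => fwdDiff y g) f

theorem continuous_iterDiff {G : Type*} [AddCommGroup G] [TopologicalSpace G]
    [IsTopologicalAddGroup G] {f : G → ℂ} (hf : Continuous f) (ys : List G) :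
    Continuous (iterDiff ys f) := by
  induction ys with
  | nil => exact hf
  | cons y ys ih =>
    change Continuous fun x => iterDiff ys f (x + y) - iterDiff ys f x
    fun_prop

/-- The continuous function `x ↦ [Δ_{x,y₁,…,y_k} * f](0) m(-x)`. -/
def diffAtZero (f : C(G, ℂ)) (m : Exponential G) (ys : List G) : C(G, ℂ) where
  toFun x := iterDiff (x :: ys) f 0 * m.check x
  continuous_toFun := by
    refine Continuous.mul ?_ m.check.continuous
    have h := continuous_iterDiff f.continuous ys
    change Continuous fun x => iterDiff ys f (0 + x) - iterDiff ys f 0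
    fun_prop

/-- The set `Î_{D,m}` of all `μ̂` with `D(μ̂)(m) = μ̂(m) = 0` and
`∫ [Δ_{x,y₁,…,y_k} * f_{D,m}](0) m(-x) dμ(x) = 0` for all `k ≥ 1` and all `y₁, …, y_k`. -/
def derivationIdeal (D : FourierAlgebra G →L[ℂ] FourierAlgebra G) (m : Exponential G) :
    Set (FourierAlgebra G) :=
  {a | ∃ μ : MeasureAlgebra G, transform μ = a ∧ D a m = 0 ∧ a m = 0 ∧
    ∀ ys : List G, ys ≠ [] → μ (diffAtZero (generatingFunction D m) m ys) = 0}

/-! ### Localizability -/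

/-- The zero set `Z(Î)`. -/
def zeroSet (I : Ideal (FourierAlgebra G)) : Set (Exponential G) := {m | ∀ a ∈ I, a m = 0}

/-- The set of the polynomial derivations that annihilate `Î` at `m`. -/
def annihilatingPolynomialDerivations (I : Ideal (FourierAlgebra G)) (m : Exponential G) :
    Set (Module.End ℂ (FourierAlgebra G)) :=
  {D | D ∈ polynomialDerivations G ∧ ∀ a ∈ I, D a m = 0}

/-- `Î` is non-localizable: some `ν̂` outside `Î` satisfies `D(ν̂)(m) = 0` for all `m` in `Z(Î)` and
all polynomial derivations `D` that annihilate `Î` at `m`. -/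
def NonLocalizable (I : Ideal (FourierAlgebra G)) : Prop :=
  ∃ a, a ∉ I ∧ ∀ m ∈ zeroSet I, ∀ D ∈ annihilatingPolynomialDerivations I m, D a m = 0

/-! ### Varieties -/

/-- The convolution `x ↦ ∫ f (x - y) dμ(y)` of a measure with a function. -/
def convFun (μ : MeasureAlgebra G) : C(G, ℂ) →ₗ[ℂ] C(G, ℂ) where
  toFun f := ⟨fun x => μ (f.comp ⟨fun y => x - y, by fun_prop⟩),
    (continuous_integral μ).comp
      (f.comp ⟨fun p : G × G => p.1 - p.2, by fun_prop⟩).curry.continuous⟩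
  map_add' f g := by
    ext x
    exact map_add μ (f.comp ⟨fun y => x - y, by fun_prop⟩) (g.comp ⟨fun y => x - y, by fun_prop⟩)
  map_smul' c f := by
    ext x
    exact map_smul μ c (f.comp ⟨fun y => x - y, by fun_prop⟩)

/-- A variety: a closed translation invariant linear subspace of `C(G)`. -/
def IsVariety (V : Submodule ℂ C(G, ℂ)) : Prop :=
  IsClosed (V : Set C(G, ℂ)) ∧
    ∀ f ∈ V, ∀ y : G, f.comp ⟨fun x => x + y, by fun_prop⟩ ∈ V

/-- A variety `V` is synthesizable if the finite dimensional varieties contained in `V` span a dense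
subspace of `V`. -/
def Synthesizable (V : Submodule ℂ C(G, ℂ)) : Prop :=
  V ≤ (sSup {W : Submodule ℂ C(G, ℂ) |
    IsVariety W ∧ FiniteDimensional ℂ W ∧ W ≤ V}).topologicalClosure

/-- `Ann I`: the functions `f` in `C(G)` with `μ * f = 0` for all `μ` with `μ̂` in `Î`. -/
def annihilator (I : Ideal (FourierAlgebra G)) : Submodule ℂ C(G, ℂ) :=
  ⨅ μ : MeasureAlgebra G, ⨅ _ : transform μ ∈ I, LinearMap.ker (convFun μ)

end

end

end SpectralSynthesis

/-!
Let `f` be the generating function of `D` at `m`. The Leibniz rule makes `f` a generalized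
polynomial (`IsDerivationOfOrder.isGeneralizedPolynomial`): its differences of high order vanish.
It is not a polynomial, that is, not in the algebra generated by the continuous additive functions.
Indeed, multiplication of measures by an additive function induces a derivation of order one, hence
multiplication by a polynomial `p` induces a polynomial derivation with generating function `p` at
every exponential (`exists_polynomialDerivation_of_mem_polynomials`).

Since a weak* continuous functional on measures is the integration against a function,
`D(μ̂)(m) = ∫ f m̌ dμ`. It follows that `Î_{D,m}` consists of the transforms of those `μ` that are
orthogonal to `W m̌`, where `W` is the space spanned by the constants and the translates of `f`
(`coe_orthogonalIdeal_eq_derivationIdeal`). So it is a closed ideal, and by the Hahn-Banach theorem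
its annihilator is the closure of `W`, up to the involution `g ↦ ǧ m`. The only zero of the ideal
is `m`, as an exponential that is a generalized polynomial is constant.

Two facts give both negative assertions. Firstly, a generalized polynomial whose translates span a
finite dimensional space is a polynomial (`IsGeneralizedPolynomial.mem_polynomials`): translations
act there by commuting unipotent operators, whose logarithms depend additively on the translation.
Secondly, a Nakayama argument (`IsGeneralizedPolynomial.mem_of_mem_closure`): if `f` lies in the
closure of the sum of the span of its differences and a finite dimensional translation invariant
space `U`, then `f ∈ U`. Together they provide a functional `φ` with `φ f = 1` that vanishes on all
finite dimensional translation invariant subspaces of the closure of `W`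
(`IsGeneralizedPolynomial.exists_functional`). Thus the finite dimensional subvarieties do not span
a dense subspace. A polynomial derivation that annihilates the ideal at `m` has a generating function
in the closure of `W`, and the translates of this function span a finite dimensional space
(`finiteDimensional_translateSpan_generatingFunction`). Hence the measure corresponding to `φ` is
killed by all these derivations, although its transform is not in the ideal.
-/

namespace SpectralSynthesis

noncomputable section

/-! ### Logarithms of unipotent elements -/

open Polynomial in
/-- A universal logarithm: for nilpotency order `k` there is one polynomial `q` without constant
term such that `exp (q(N)) = 1 + N` whenever `N ^ k = 0`. -/
theorem exists_polynomial_exp_eq_one_add (A : Type*) [Ring A] [Algebra ℚ A] (k : ℕ) :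
    ∃ q : ℚ[X], X ∣ q ∧
      ∀ N : A, N ^ k = 0 → IsNilpotent.exp (aeval N q) = 1 + N := by
  induction k with
  | zero =>
    refine ⟨0, dvd_zero _, fun N hN => ?_⟩
    have : Subsingleton A := subsingleton_of_zero_eq_one (by simpa using hN.symm)
    exact Subsingleton.elim _ _
  | succ k ih =>
    obtain ⟨q, hq, h⟩ := ih
    rcases Nat.eq_zero_or_pos k with rfl | hk
    · refine ⟨0, dvd_zero _, fun N hN => ?_⟩
      obtain rfl : N = 0 := by simpa using hN
      simp
    -- `exp (-N) * (1 + N) = 1 + r(N)` with `r` divisible by `X ^ 2`, so `r(N) ^ k = 0`.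
    let r : ℚ[X] := (∑ i ∈ Finset.range (k + 1), C ((i.factorial : ℚ)⁻¹) * (-X) ^ i) * (1 + X) - 1
    have hr : X ^ 2 ∣ r := by
      obtain ⟨j, rfl⟩ : ∃ j, k = j + 1 := ⟨k - 1, by omega⟩
      have : r = X ^ 2 * (-1 + (∑ i ∈ Finset.range j,
          C (((i + 2).factorial : ℚ)⁻¹) * (-X) ^ i) * (1 + X)) := by
        simp only [r]
        rw [Finset.sum_range_succ', Finset.sum_range_succ']
        have : ∀ i, C (((i + 1 + 1).factorial : ℚ)⁻¹) * (-X : ℚ[X]) ^ (i + 1 + 1) =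
            X ^ 2 * (C (((i + 2).factorial : ℚ)⁻¹) * (-X) ^ i) := fun i => by ring
        simp only [this, ← Finset.mul_sum]
        simp
        ring
      exact ⟨_, this⟩
    refine ⟨X + q.comp r, ?_, fun N hN => ?_⟩
    · refine dvd_add dvd_rfl ?_
      obtain ⟨s, rfl⟩ := hq
      rw [mul_comp, X_comp]
      exact Dvd.dvd.mul_right ((dvd_pow_self X two_ne_zero).trans hr) _
    have hr' : (aeval N r) ^ k = 0 := by
      obtain ⟨s, hs⟩ := hr
      rw [← map_pow, hs, mul_pow, ← pow_mul, map_mul, map_pow, aeval_X,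
        pow_eq_zero_of_le (by omega) hN, zero_mul]
    have hNn : IsNilpotent N := ⟨_, hN⟩
    have hexp : IsNilpotent.exp (-N) * (1 + N) = 1 + aeval N r := by
      have : (-N) ^ (k + 1) = 0 := by rw [neg_pow, hN, mul_zero]
      rw [IsNilpotent.exp_eq_sum this]
      simp [r, Algebra.smul_def]
    have hqn : IsNilpotent (aeval N (q.comp r)) := by
      obtain ⟨s, rfl⟩ := hq
      refine ⟨k, ?_⟩
      rw [mul_comp, X_comp, ← map_pow, mul_pow, map_mul, map_pow, hr', zero_mul]
    have hc : Commute N (aeval N (q.comp r)) := by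
      have := (commute_X (q.comp r)).map (aeval N (R := ℚ)).toRingHom
      simpa using this
    rw [map_add, aeval_X, IsNilpotent.exp_add_of_commute hc hNn hqn, aeval_comp, h _ hr', ← hexp,
      ← mul_assoc, IsNilpotent.exp_mul_exp_neg_self hNn, one_mul]

/-- The exponential is injective on commuting nilpotent elements. -/
theorem eq_of_exp_eq_of_commute {A : Type*} [Ring A] [Algebra ℚ A] {a b : A} (hab : Commute a b)
    (ha : IsNilpotent a) (hb : IsNilpotent b)
    (h : IsNilpotent.exp a = IsNilpotent.exp b) : a = b := by
  have hn : IsNilpotent (a - b) := hab.isNilpotent_sub ha hb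
  have h1 : IsNilpotent.exp (a - b) = 1 := by
    rw [sub_eq_add_neg, IsNilpotent.exp_add_of_commute hab.neg_right ha hb.neg, h,
      IsNilpotent.exp_mul_exp_neg_self hb]
  -- `exp c - 1 = c * (1 + nilpotent)`
  obtain ⟨k, hk⟩ := hn
  have hk' : (a - b) ^ (k + 1) = 0 := by rw [pow_succ, hk, zero_mul]
  set c := a - b
  have h2 : c * ∑ i ∈ Finset.range k, (((i + 1).factorial : ℚ)⁻¹) • c ^ i = 0 := by
    rw [IsNilpotent.exp_eq_sum hk', Finset.sum_range_succ'] at h1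
    simpa [Finset.mul_sum, pow_succ'] using h1
  rcases k with _ | k
  · have : Subsingleton A := subsingleton_of_zero_eq_one (by simpa using hk.symm)
    exact Subsingleton.elim _ _
  have hu : IsUnit (∑ i ∈ Finset.range (k + 1), (((i + 1).factorial : ℚ)⁻¹) • c ^ i) := by
    rw [Finset.sum_range_succ']
    have hcn : IsNilpotent
        (∑ i ∈ Finset.range k, (((i + 1 + 1).factorial : ℚ)⁻¹) • c ^ (i + 1)) := by
      have : ∑ i ∈ Finset.range k, (((i + 1 + 1).factorial : ℚ)⁻¹) • c ^ (i + 1) =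
          c * ∑ i ∈ Finset.range k, (((i + 1 + 1).factorial : ℚ)⁻¹) • c ^ i := by
        simp [Finset.mul_sum, pow_succ']
      rw [this]
      refine Commute.isNilpotent_mul_right ?_ ⟨_, hk⟩
      exact Commute.sum_right _ _ _ fun i _ => ((Commute.refl c).pow_right i).smul_right _
    simpa using hcn.isUnit_add_one
  exact sub_eq_zero.1 ((hu.mul_left_eq_zero).1 h2)

end

noncomputable section
variable {G : Type*} [AddCommGroup G] [TopologicalSpace G]

/-! ### Polynomials on a topological Abelian group -/

variable (G) in
/-- The algebra of polynomials on `G`, generated by the continuous additive functions. -/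
def polynomials : Subalgebra ℂ C(G, ℂ) :=
  Algebra.adjoin ℂ {a | ∀ x y, a (x + y) = a x + a y}

open scoped Matrix.Norms.Operator in
open Polynomial in
/-- The entries of a continuous unipotent matrix representation are polynomials: the logarithm of
the representation is additive, and exponentiating a nilpotent matrix is a polynomial map. -/
theorem exists_polynomial_eq_entry {d : Type*} [Fintype d] [DecidableEq d]
    (M : G → Matrix d d ℂ) (hM : Continuous M) (hadd : ∀ x y, M (x + y) = M x * M y) (n : ℕ)
    (hn : ∀ x, (M x - 1) ^ n = 0) (i j : d) : ∃ p ∈ polynomials G, ∀ x, p x = M x i j := by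
  obtain ⟨q, hq, hexp⟩ := exists_polynomial_exp_eq_one_add (Matrix d d ℂ) n
  let N : G → Matrix d d ℂ := fun x => M x - 1
  let L : G → Matrix d d ℂ := fun x => aeval (N x) q
  have hL : ∀ x, IsNilpotent.exp (L x) = M x := fun x => by
    rw [hexp _ (hn x)]; simp
  have hLn : ∀ x, (L x) ^ n = 0 := fun x => by
    obtain ⟨s, rfl⟩ := hq
    simp only [L]
    rw [← map_pow, mul_pow, map_mul, map_pow, aeval_X, hn, zero_mul]
  have hcomm : ∀ x y, Commute (L x) (L y) := fun x y => by
    have h0 : Commute (M x) (M y) := by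
      rw [Commute, SemiconjBy, ← hadd, ← hadd, add_comm]
    have h1 : Commute (N x) (N y) :=
      (h0.sub_left (Commute.one_left _)).sub_right
        ((Commute.one_right _).sub_left (Commute.one_left _))
    have h2 : ∀ {A B : Matrix d d ℂ}, Commute A B → Commute A (aeval B q) := fun {A B} h => by
      rw [aeval_eq_sum_range]
      exact Commute.sum_right _ _ _ fun i _ => (h.pow_right i).smul_right _
    exact (h2 (h2 h1).symm).symm
  have hLadd : ∀ x y, L (x + y) = L x + L y := fun x y => by
    have h1 : Commute (L (x + y)) (L x + L y) := (hcomm _ _).add_right (hcomm _ _)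
    refine eq_of_exp_eq_of_commute h1 ⟨n, hLn _⟩
      ((hcomm x y).isNilpotent_add ⟨n, hLn _⟩ ⟨n, hLn _⟩) ?_
    rw [hL, hadd, IsNilpotent.exp_add_of_commute (hcomm x y) ⟨n, hLn _⟩ ⟨n, hLn _⟩, hL, hL]
  have hLc : Continuous L := by
    have h1 : Continuous fun A : Matrix d d ℂ => aeval A q := by
      simp only [aeval_def, eval₂_eq_sum_range]
      fun_prop
    exact h1.comp (hM.sub continuous_const)
  have hpow : ∀ (k : ℕ) (i j : d), ∃ p ∈ polynomials G, ∀ x, p x = (L x ^ k) i j := by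
    intro k
    induction k with
    | zero =>
      intro i j
      refine ⟨algebraMap ℂ _ ((1 : Matrix d d ℂ) i j), Subalgebra.algebraMap_mem _ _, fun x => ?_⟩
      simp
    | succ k ih =>
      intro i j
      choose p hp hp' using ih
      let a : d → d → C(G, ℂ) := fun i j => ⟨fun x => L x i j, hLc.matrix_elem i j⟩
      have ha : ∀ i j, a i j ∈ polynomials G := fun i j => Algebra.subset_adjoin fun x y => by
        simp [a, hLadd]
      refine ⟨∑ l, p i l * a l j, Subalgebra.sum_mem _ fun l _ =>
        Subalgebra.mul_mem _ (hp i l) (ha l j), fun x => ?_⟩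
      simp [pow_succ, Matrix.mul_apply, hp', a]
  choose p hp hp' using hpow
  refine ⟨∑ k ∈ Finset.range n, ((k.factorial : ℂ)⁻¹) • p k i j, Subalgebra.sum_mem _ fun k _ =>
    Subalgebra.smul_mem _ (hp k i j) _, fun x => ?_⟩
  rw [← hL, IsNilpotent.exp_eq_sum (hLn x)]
  simp [Matrix.sum_apply, hp', Matrix.smul_apply, Rat.smul_def]

/-- Matrix coefficients of a finite dimensional continuous unipotent representation of `G` are
polynomials. -/
theorem exists_polynomial_eq_coefficient {E : Type*} [AddCommGroup E] [Module ℂ E]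
    [FiniteDimensional ℂ E] (T : G → Module.End ℂ E)
    (hT : ∀ (l : E →ₗ[ℂ] ℂ) (v : E), Continuous fun x => l (T x v))
    (hadd : ∀ x y, T (x + y) = T x * T y) (n : ℕ) (hn : ∀ x, (T x - 1) ^ n = 0)
    (l : E →ₗ[ℂ] ℂ) (v : E) : ∃ p ∈ polynomials G, ∀ x, p x = l (T x v) := by
  let b := Module.finBasis ℂ E
  let M : G → Matrix _ _ ℂ := fun y => LinearMap.toMatrixAlgEquiv b (T y)
  have hM : Continuous M := by
    refine continuous_matrix fun i j => ?_
    simp only [M, LinearMap.toMatrixAlgEquiv_apply]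
    exact hT (b.coord i) (b j)
  choose p hp hp' using fun i j => exists_polynomial_eq_entry M hM
    (fun x y => by simp only [M, hadd, map_mul]) n
    (fun x => by
      simp only [M]
      rw [← map_one (LinearMap.toMatrixAlgEquiv b), ← map_sub, ← map_pow, hn, map_zero]) i j
  refine ⟨∑ j, b.repr v j • ∑ i, l (b i) • p i j, Subalgebra.sum_mem _ fun j _ =>
    Subalgebra.smul_mem _ (Subalgebra.sum_mem _ fun i _ => Subalgebra.smul_mem _ (hp i j) _) _,
    fun x => ?_⟩
  conv_rhs => rw [← b.sum_repr v]
  simp only [map_sum, map_smul, ContinuousMap.coe_sum, ContinuousMap.coe_smul, Finset.sum_apply,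
    Pi.smul_apply, hp', M, LinearMap.toMatrixAlgEquiv_apply]
  refine Finset.sum_congr rfl fun j _ => ?_
  have h : l (T x (b j)) = ∑ i, b.repr (T x (b j)) i * l (b i) := by
    conv_lhs => rw [← b.sum_repr (T x (b j)), map_sum]
    simp only [map_smul, smul_eq_mul]
  rw [h]
  simp [mul_comm]

/-- Matrix coefficients of the restriction of a representation of `G` to a finite dimensional
invariant subspace, on which it is continuous and unipotent, are polynomials. -/
theorem exists_polynomial_eq_coefficient_of_invariant {E : Type*} [AddCommGroup E] [Module ℂ E]
    [TopologicalSpace E] [IsTopologicalAddGroup E] [ContinuousSMul ℂ E] [T2Space E]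
    (T : G → E →ₗ[ℂ] E) (V : Submodule ℂ E) [FiniteDimensional ℂ V]
    (hV : ∀ x, ∀ v ∈ V, T x v ∈ V) (hT : ∀ v ∈ V, Continuous fun x => T x v)
    (hadd : ∀ x y v, T (x + y) v = T x (T y v)) (n : ℕ)
    (hn : ∀ x, ∀ v ∈ V, (fun w => T x w - w)^[n] v = 0)
    (l : E →ₗ[ℂ] ℂ) (v : E) (hv : v ∈ V) : ∃ p ∈ polynomials G, ∀ x, p x = l (T x v) := by
  let S : G → Module.End ℂ V := fun x => (T x).restrict (hV x)
  have hpow : ∀ x (k : ℕ) (w : V), (((S x - 1) ^ k) w : E) = (fun w => T x w - w)^[k] w := by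
    intro x k w
    induction k with
    | zero => rfl
    | succ k ih => rw [pow_succ', Function.iterate_succ_apply', ← ih]; rfl
  exact exists_polynomial_eq_coefficient S
    (fun l w => (LinearMap.continuous_of_finiteDimensional l).comp
      ((hT w w.2).subtype_mk fun x => (S x w).2))
    (fun x y => LinearMap.ext fun w => Subtype.ext (hadd x y w)) n
    (fun x => LinearMap.ext fun w => Subtype.ext (by rw [hpow, hn x w w.2]; rfl))
    (l ∘ₗ V.subtype) ⟨v, hv⟩

/-! ### Translations and differences -/

variable [IsTopologicalAddGroup G]

/-- The translation `f ↦ f (· + y)`, as a continuous linear operator on `C(G)`. -/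
def translate (y : G) : C(G, ℂ) →L[ℂ] C(G, ℂ) :=
  ContinuousMap.compCLM ℂ ℂ ⟨fun x => x + y, by fun_prop⟩

@[simp] theorem translate_apply (y : G) (f : C(G, ℂ)) (x : G) : translate y f x = f (x + y) := rfl

theorem translate_add (y z : G) (f : C(G, ℂ)) :
    translate (y + z) f = translate y (translate z f) := by
  ext x
  simp [add_assoc]

/-- The iterated difference operator `Δ_{y₁,…,y_k}` on `C(G)`. -/
def diffs : List G → C(G, ℂ) →L[ℂ] C(G, ℂ)
  | [] => ContinuousLinearMap.id ℂ _
  | y :: ys => (translate y - ContinuousLinearMap.id ℂ _) ∘L diffs ys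

@[simp] theorem diffs_nil (f : C(G, ℂ)) : diffs [] f = f := rfl

theorem diffs_cons (y : G) (ys : List G) (f : C(G, ℂ)) :
    diffs (y :: ys) f = translate y (diffs ys f) - diffs ys f := rfl

theorem coe_diffs (ys : List G) (f : C(G, ℂ)) : ⇑(diffs ys f) = iterDiff ys f := by
  induction ys with
  | nil => rfl
  | cons y ys ih =>
    change _ = fun x => iterDiff ys f (x + y) - iterDiff ys f x
    rw [← ih]
    rfl

theorem diffs_append (ys zs : List G) (f : C(G, ℂ)) :
    diffs (ys ++ zs) f = diffs ys (diffs zs f) := by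
  induction ys with
  | nil => rfl
  | cons y ys ih => rw [List.cons_append, diffs_cons, ih, diffs_cons]

theorem translate_comm (y z : G) (f : C(G, ℂ)) :
    translate y (translate z f) = translate z (translate y f) := by
  rw [← translate_add, ← translate_add, add_comm]

theorem diffs_translate (y : G) (ys : List G) (f : C(G, ℂ)) :
    diffs ys (translate y f) = translate y (diffs ys f) := by
  induction ys with
  | nil => rfl
  | cons z ys ih => rw [diffs_cons, ih, diffs_cons, map_sub, translate_comm]

/-- A subspace of `C(G)` is translation invariant. -/
def TranslationInvariant (U : Submodule ℂ C(G, ℂ)) : Prop := ∀ y, ∀ f ∈ U, translate y f ∈ U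

theorem TranslationInvariant.diffs_mem {U : Submodule ℂ C(G, ℂ)} (hU : TranslationInvariant U)
    (ys : List G) {f : C(G, ℂ)} (hf : f ∈ U) : diffs ys f ∈ U := by
  induction ys with
  | nil => simpa [diffs] using hf
  | cons y ys ih =>
    exact U.sub_mem (hU _ _ ih) ih

theorem TranslationInvariant.sup {U V : Submodule ℂ C(G, ℂ)} (hU : TranslationInvariant U)
    (hV : TranslationInvariant V) : TranslationInvariant (U ⊔ V) := by
  intro y f hf
  obtain ⟨u, hu, v, hv, rfl⟩ := Submodule.mem_sup.1 hf
  rw [map_add]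
  exact Submodule.add_mem_sup (hU y u hu) (hV y v hv)

/-- The span of the translates of `f`. -/
def translateSpan (f : C(G, ℂ)) : Submodule ℂ C(G, ℂ) :=
  Submodule.span ℂ (Set.range fun y => translate y f)

theorem self_mem_translateSpan (f : C(G, ℂ)) : f ∈ translateSpan f :=
  Submodule.subset_span ⟨0, by ext x; simp⟩

theorem translationInvariant_translateSpan (f : C(G, ℂ)) :
    TranslationInvariant (translateSpan f) := by
  intro z g hg
  change g ∈ (translateSpan f).comap (translate z).toLinearMap
  refine (Submodule.span_le.2 ?_) hg
  rintro _ ⟨y, rfl⟩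
  refine Submodule.subset_span ⟨z + y, ?_⟩
  simp [translate_add]

theorem translateSpan_le {f : C(G, ℂ)} {U : Submodule ℂ C(G, ℂ)} (hU : TranslationInvariant U)
    (hf : f ∈ U) : translateSpan f ≤ U := by
  refine Submodule.span_le.2 ?_
  rintro _ ⟨y, rfl⟩
  exact hU y f hf

/-- `f` is a generalized polynomial of degree less than `n`: all its differences of order at least
`n` vanish. -/
def IsGeneralizedPolynomial (n : ℕ) (f : G → ℂ) : Prop :=
  ∀ ys : List G, n ≤ ys.length → iterDiff ys f = 0

theorem IsGeneralizedPolynomial.diffs_eq_zero {n : ℕ} {f : C(G, ℂ)}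
    (hf : IsGeneralizedPolynomial n f) {ys : List G} (hys : n ≤ ys.length) : diffs ys f = 0 := by
  apply DFunLike.coe_injective
  rw [coe_diffs, hf ys hys]
  rfl

/-- A generalized polynomial whose translates span a finite dimensional space is a polynomial: on
that space translations form a continuous unipotent representation. -/
theorem IsGeneralizedPolynomial.mem_polynomials {n : ℕ} {f : C(G, ℂ)}
    (hf : IsGeneralizedPolynomial n f) {U : Submodule ℂ C(G, ℂ)} [FiniteDimensional ℂ U]
    (hU : TranslationInvariant U) (hfU : f ∈ U) : f ∈ polynomials G := by
  have : FiniteDimensional ℂ (translateSpan f) :=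
    Submodule.finiteDimensional_of_le (translateSpan_le hU hfU)
  let V := translateSpan f
  have hV := translationInvariant_translateSpan f
  have hdeg : ∀ g ∈ V, ∀ ys : List G, n ≤ ys.length → diffs ys g = 0 := by
    intro g hg ys hys
    change g ∈ LinearMap.ker (diffs ys).toLinearMap
    refine (Submodule.span_le.2 ?_) hg
    rintro _ ⟨y, rfl⟩
    change diffs ys (translate y f) = 0
    rw [diffs_translate, hf.diffs_eq_zero hys, map_zero]
  have hpow : ∀ (x : G) (k : ℕ) (g : C(G, ℂ)),
      (fun w => translate x w - w)^[k] g = diffs (List.replicate k x) g := by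
    intro x k g
    induction k with
    | zero => rfl
    | succ k ih => rw [List.replicate_succ, diffs_cons, Function.iterate_succ_apply', ih]
  obtain ⟨p, hp, hp'⟩ := exists_polynomial_eq_coefficient_of_invariant
    (fun y => (translate y).toLinearMap) V hV (fun v _ => (shifts v).continuous) translate_add n
    (fun x v hv => (hpow x n v).trans (hdeg v hv _ (by simp)))
    (ContinuousMap.evalCLM ℂ (0 : G)).toLinearMap f (self_mem_translateSpan f)
  convert hp
  ext y
  rw [hp']
  change f y = f (0 + y)
  rw [zero_add]

end

noncomputable section
variable {G : Type*} [AddCommGroup G] [TopologicalSpace G]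

/-! ### Exponentials and weak* continuous functionals -/

/-- The exponential `m`, as an element of `C(G)`. -/
def Exponential.toContinuousMap (m : Exponential G) : C(G, ℂ) := ⟨m.1, m.2⟩

theorem Exponential.mul_neg_self (m : Exponential G) (x : G) : m.1 x * m.1 (-x) = 1 := by
  rw [← AddChar.map_add_eq_mul, add_neg_cancel, AddChar.map_zero_eq_one]

variable [IsTopologicalAddGroup G]

theorem Exponential.toContinuousMap_mul_check (m : Exponential G) :
    m.toContinuousMap * m.check = 1 := by
  ext x
  exact m.mul_neg_self x

/-- A weak* continuous functional is the evaluation at a vector. -/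
theorem exists_eq_eval_of_continuous {E : Type*} [AddCommGroup E] [Module ℂ E]
    [TopologicalSpace E] (Λ : WeakDual ℂ E →ₗ[ℂ] ℂ) (h : Continuous Λ) :
    ∃ e : E, ∀ ν : WeakDual ℂ E, Λ ν = ν e := by
  let Λ' : StrongDual ℂ (WeakBilin (topDualPairing ℂ E)) :=
    { toFun := fun ν => Λ ν
      map_add' := fun x y => map_add Λ x y
      map_smul' := fun c x => map_smul Λ c x
      cont := h }
  obtain ⟨e, he⟩ := LinearMap.dualEmbedding_surjective (topDualPairing ℂ E) Λ'
  exact ⟨e, fun ν => (DFunLike.congr_fun he ν).symm⟩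

variable [LocallyCompactSpace G]

/-! ### Operators on the Fourier algebra -/

theorem transform_surjective : Function.Surjective (transform (G := G)) := by
  rintro ⟨_, μ, rfl⟩
  exact ⟨μ, rfl⟩

theorem FourierAlgebra.ext {a b : FourierAlgebra G} (h : ∀ m, a m = b m) : a = b :=
  Subtype.ext (funext h)

@[simp] theorem FourierAlgebra.add_apply (a b : FourierAlgebra G) (m : Exponential G) :
    (a + b) m = a m + b m := rfl

@[simp] theorem FourierAlgebra.sub_apply (a b : FourierAlgebra G) (m : Exponential G) :
    (a - b) m = a m - b m := rfl

@[simp] theorem FourierAlgebra.mul_apply (a b : FourierAlgebra G) (m : Exponential G) :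
    (a * b) m = a m * b m := rfl

@[simp] theorem FourierAlgebra.smul_apply (c : ℂ) (a : FourierAlgebra G) (m : Exponential G) :
    (c • a) m = c * a m := rfl

theorem transform_conv (μ ν : MeasureAlgebra G) :
    transform (conv μ ν) = transform μ * transform ν :=
  Subtype.ext (transformFun_conv μ ν)

theorem transform_dirac_add (x y : G) :
    transform (dirac (x + y)) = transform (dirac x) * transform (dirac y) :=
  FourierAlgebra.ext fun m => by
    change m.1 (-(x + y)) = m.1 (-x) * m.1 (-y)
    rw [← AddChar.map_add_eq_mul, neg_add]

/-- The evaluation at an exponential, as a linear functional on `A(G)`. -/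
def evalAt (m : Exponential G) : FourierAlgebra G →ₗ[ℂ] ℂ where
  toFun a := a m
  map_add' _ _ := rfl
  map_smul' _ _ := rfl

@[simp] theorem evalAt_apply (m : Exponential G) (a : FourierAlgebra G) : evalAt m a = a m := rfl

theorem continuous_transform : Continuous (transform (G := G)) := continuous_coinduced_rng

theorem isOpenQuotientMap_transform : IsOpenQuotientMap (transform (G := G)) where
  surjective := transform_surjective
  continuous := continuous_transform
  isOpenMap := fun U hU => by
    refine isOpen_coinduced.2 ?_
    have : transform ⁻¹' (transform '' U) =
        ⋃ κ ∈ LinearMap.ker (transform (G := G)), (fun μ => μ + κ) ⁻¹' U := by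
      ext μ
      simp only [Set.mem_preimage, Set.mem_image, Set.mem_iUnion, LinearMap.mem_ker]
      constructor
      · rintro ⟨ν, hν, h⟩
        exact ⟨ν - μ, by rw [map_sub, h, sub_self], by simpa using hν⟩
      · rintro ⟨κ, hκ, h⟩
        exact ⟨_, h, by rw [map_add, hκ, add_zero]⟩
    rw [this]
    exact isOpen_biUnion fun κ _ => hU.preimage (continuous_add_const κ)

instance : ContinuousAdd (FourierAlgebra G) where
  continuous_add := by
    have h := isOpenQuotientMap_transform (G := G)
    refine (h.prodMap h).isQuotientMap.continuous_iff.2 ?_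
    have : (fun p : FourierAlgebra G × FourierAlgebra G => p.1 + p.2) ∘
        Prod.map transform transform = transform ∘ fun p => p.1 + p.2 := by
      ext1 p
      exact (map_add transform p.1 p.2).symm
    rw [this]
    exact continuous_transform.comp continuous_add

instance : ContinuousConstSMul ℂ (FourierAlgebra G) where
  continuous_const_smul c := by
    refine continuous_coinduced_dom.2 ?_
    have : (fun a : FourierAlgebra G => c • a) ∘ transform =
        transform ∘ fun μ : MeasureAlgebra G => c • μ := by
      ext1 μ
      exact (map_smul transform c μ).symm
    rw [this]
    exact continuous_transform.comp (continuous_const_smul c)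

theorem continuous_of_mem_polynomialDerivations {E : Module.End ℂ (FourierAlgebra G)}
    (hE : E ∈ polynomialDerivations G) : Continuous E := by
  induction hE using Algebra.adjoin_induction with
  | mem D hD => exact hD.1
  | algebraMap c =>
    exact continuous_const_smul (T := FourierAlgebra G) c
  | add E F _ _ hE hF => exact hE.add hF
  | mul E F _ _ hE hF => exact hE.comp hF

/-- Every polynomial derivation satisfies a Leibniz rule: it expands on products as a finite sum
of products of polynomial derivations. -/
theorem exists_leibniz_expansion {E : Module.End ℂ (FourierAlgebra G)}
    (hE : E ∈ polynomialDerivations G) :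
    ∃ (ι : Type) (_ : Fintype ι) (P Q : ι → Module.End ℂ (FourierAlgebra G)),
      (∀ i, P i ∈ polynomialDerivations G) ∧ (∀ i, Q i ∈ polynomialDerivations G) ∧
      ∀ a b, E (a * b) = ∑ i, P i a * Q i b := by
  induction hE using Algebra.adjoin_induction with
  | mem D hD =>
    have hD' : D ∈ polynomialDerivations G := Algebra.subset_adjoin hD
    refine ⟨Bool, inferInstance, fun i => cond i D 1, fun i => cond i 1 D, ?_, ?_, fun a b => ?_⟩
    · rintro (_ | _)
      exacts [Subalgebra.one_mem _, hD']
    · rintro (_ | _)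
      exacts [hD', Subalgebra.one_mem _]
    · simpa using hD.2 a b
  | algebraMap c =>
    refine ⟨Unit, inferInstance, fun _ => algebraMap ℂ _ c, fun _ => 1,
      fun _ => Subalgebra.algebraMap_mem _ c, fun _ => Subalgebra.one_mem _, fun a b => ?_⟩
    simp [Module.algebraMap_end_apply]
  | add E F _ _ hE hF =>
    obtain ⟨ι, _, P, Q, hP, hQ, h⟩ := hE
    obtain ⟨κ, _, P', Q', hP', hQ', h'⟩ := hF
    refine ⟨ι ⊕ κ, inferInstance, Sum.elim P P', Sum.elim Q Q', ?_, ?_, fun a b => ?_⟩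
    · rintro (i | i)
      exacts [hP i, hP' i]
    · rintro (i | i)
      exacts [hQ i, hQ' i]
    · simp [h, h']
  | mul E F _ _ hE hF =>
    obtain ⟨ι, _, P, Q, hP, hQ, h⟩ := hE
    obtain ⟨κ, _, P', Q', hP', hQ', h'⟩ := hF
    refine ⟨κ × ι, inferInstance, fun p => P p.2 * P' p.1, fun p => Q p.2 * Q' p.1,
      fun p => Subalgebra.mul_mem _ (hP _) (hP' _), fun p => Subalgebra.mul_mem _ (hQ _) (hQ' _),
      fun a b => ?_⟩
    simp [h, h', Fintype.sum_prod_type]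

/-- A continuous operator on `A(G)` followed by the evaluation at `m` is the integration against
the generating function times `m̌`, since a weak* continuous functional on `M_c(G)` is given by a
function. -/
theorem apply_transform_eq_integral (D : FourierAlgebra G →L[ℂ] FourierAlgebra G)
    (m : Exponential G) (μ : MeasureAlgebra G) :
    D (transform μ) m = μ (generatingFunction D m * m.check) := by
  obtain ⟨h, hΛ⟩ : ∃ h : C(G, ℂ), ∀ ν : MeasureAlgebra G, D (transform ν) m = ν h :=
    exists_eq_eval_of_continuous (evalAt m ∘ₗ D.toLinearMap ∘ₗ transform)
      ((continuous_eval m).comp (D.continuous.comp continuous_transform))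
  have : generatingFunction D m * m.check = h := by
    ext x
    change D (transform (dirac x)) m * m.1 x * m.1 (-x) = h x
    rw [hΛ, mul_assoc, m.mul_neg_self, mul_one]
    rfl
  rw [hΛ, this]

/-- The translates of the generating function of a polynomial derivation span a finite dimensional
space. -/
theorem finiteDimensional_translateSpan_generatingFunction
    (E : FourierAlgebra G →L[ℂ] FourierAlgebra G)
    (hE : (E : FourierAlgebra G →ₗ[ℂ] FourierAlgebra G) ∈ polynomialDerivations G)
    (m : Exponential G) : FiniteDimensional ℂ (translateSpan (generatingFunction E m)) := by
  obtain ⟨ι, _, P, Q, hP, hQ, h⟩ := exists_leibniz_expansion hE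
  let g : ι → C(G, ℂ) := fun i =>
    generatingFunction ⟨P i, continuous_of_mem_polynomialDerivations (hP i)⟩ m
  have hfin : FiniteDimensional ℂ (Submodule.span ℂ (Set.range g)) :=
    FiniteDimensional.span_of_finite ℂ (Set.finite_range g)
  refine Submodule.finiteDimensional_of_le (S₂ := Submodule.span ℂ (Set.range g)) ?_
  refine Submodule.span_le.2 ?_
  rintro _ ⟨y, rfl⟩
  have : translate y (generatingFunction E m) =
      ∑ i, (Q i (transform (dirac y)) m * m.1 y) • g i := by
    ext x
    change E (transform (dirac (x + y))) m * m.1 (x + y) = _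
    have h1 := congrArg (evalAt m) (h (transform (dirac x)) (transform (dirac y)))
    simp only [map_sum, evalAt_apply, FourierAlgebra.mul_apply] at h1
    rw [transform_dirac_add, AddChar.map_add_eq_mul]
    erw [h1]
    rw [Finset.sum_mul, ContinuousMap.coe_sum, Finset.sum_apply]
    refine Finset.sum_congr rfl fun i _ => ?_
    change _ = Q i (transform (dirac y)) m * m.1 y * (P i (transform (dirac x)) m * m.1 x)
    ring
  change translate y (generatingFunction E m) ∈ Submodule.span ℂ (Set.range g)
  rw [this]
  exact Submodule.sum_mem _ fun i _ => Submodule.smul_mem _ _ (Submodule.subset_span ⟨i, rfl⟩)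

/-! ### Generating functions of derivations are generalized polynomials -/

theorem iterDiff_add {G : Type*} [AddCommGroup G] (ys : List G) (f g : G → ℂ) :
    iterDiff ys (f + g) = iterDiff ys f + iterDiff ys g := by
  induction ys with
  | nil => rfl
  | cons y ys ih =>
    change fwdDiff y (iterDiff ys (f + g)) = fwdDiff y (iterDiff ys f) + fwdDiff y (iterDiff ys g)
    rw [ih, fwdDiff_add]

theorem iterDiff_smul {G : Type*} [AddCommGroup G] (ys : List G) (c : ℂ) (f : G → ℂ) :
    iterDiff ys (c • f) = c • iterDiff ys f := by
  induction ys with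
  | nil => rfl
  | cons y ys ih =>
    change fwdDiff y (iterDiff ys (c • f)) = c • fwdDiff y (iterDiff ys f)
    rw [ih, fwdDiff_const_smul]

theorem iterDiff_concat {G : Type*} [AddCommGroup G] (ys : List G) (y : G) (f : G → ℂ) :
    iterDiff (ys ++ [y]) f = iterDiff ys (fwdDiff y f) := by
  simp [iterDiff]

theorem iterDiff_zero {G : Type*} [AddCommGroup G] (ys : List G) :
    iterDiff ys (0 : G → ℂ) = 0 := by
  simpa using iterDiff_smul ys 0 (0 : G → ℂ)

theorem isGeneralizedPolynomial_const {G : Type*} [AddCommGroup G] (c : ℂ) :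
    IsGeneralizedPolynomial 1 (fun _ : G => c) := by
  intro ys hys
  obtain ⟨zs, y, rfl⟩ := (List.eq_nil_or_concat' ys).resolve_left (by rintro rfl; simp at hys)
  rw [iterDiff_concat, fwdDiff_const]
  exact iterDiff_zero zs

theorem IsGeneralizedPolynomial.mono {G : Type*} [AddCommGroup G] {n k : ℕ} (h : n ≤ k)
    {f : G → ℂ} (hf : IsGeneralizedPolynomial n f) : IsGeneralizedPolynomial k f :=
  fun ys hys => hf ys (h.trans hys)

theorem IsGeneralizedPolynomial.add {G : Type*} [AddCommGroup G] {n : ℕ}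
    {f g : G → ℂ} (hf : IsGeneralizedPolynomial n f) (hg : IsGeneralizedPolynomial n g) :
    IsGeneralizedPolynomial n (f + g) :=
  fun ys hys => by rw [iterDiff_add, hf ys hys, hg ys hys, add_zero]

theorem IsGeneralizedPolynomial.smul {G : Type*} [AddCommGroup G] {n : ℕ}
    {f : G → ℂ} (c : ℂ) (hf : IsGeneralizedPolynomial n f) : IsGeneralizedPolynomial n (c • f) :=
  fun ys hys => by rw [iterDiff_smul, hf ys hys, smul_zero]

theorem isGeneralizedPolynomial_of_fwdDiff {G : Type*} [AddCommGroup G] {n : ℕ}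
    {f : G → ℂ} (hf : ∀ y, IsGeneralizedPolynomial n (fwdDiff y f)) :
    IsGeneralizedPolynomial (n + 1) f := by
  intro ys hys
  obtain ⟨zs, y, rfl⟩ := (List.eq_nil_or_concat' ys).resolve_left (by rintro rfl; simp at hys)
  rw [iterDiff_concat]
  exact hf y zs (by simpa using hys)

/-- The generating function of a derivation of order `n` is a generalized polynomial of degree at
most `n`: its difference with step `y` is, up to a constant, the generating function of the
Leibniz defect with respect to `δ̂_y`. -/
theorem IsDerivationOfOrder.isGeneralizedPolynomial (m : Exponential G) {n : ℕ}
    {D : FourierAlgebra G →ₗ[ℂ] FourierAlgebra G} (hD : IsDerivationOfOrder n D) :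
    IsGeneralizedPolynomial (n + 1) fun x => D (transform (dirac x)) m * m.1 x := by
  have hdirac : ∀ x, transform (dirac x) m = m.1 (-x) := fun _ => rfl
  induction n using Nat.strong_induction_on generalizing D with
  | _ n ih =>
    match n, hD with
    | 0, ⟨c, hc⟩ =>
      convert isGeneralizedPolynomial_const (G := G) c using 2 with x
      rw [hc]
      simp [hdirac, mul_assoc, mul_comm (m.1 (-x)), m.mul_neg_self]
    | 1, hD =>
      refine isGeneralizedPolynomial_of_fwdDiff fun y => ?_
      convert isGeneralizedPolynomial_const (G := G) (D (transform (dirac y)) m * m.1 y) using 1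
      funext x
      simp only [fwdDiff]
      rw [transform_dirac_add, hD.2, AddChar.map_add_eq_mul]
      simp only [FourierAlgebra.add_apply, FourierAlgebra.mul_apply, hdirac]
      linear_combination (D (transform (dirac x)) m * m.1 x) * m.mul_neg_self y +
        (D (transform (dirac y)) m * m.1 y) * m.mul_neg_self x
    | n + 2, hD =>
      refine isGeneralizedPolynomial_of_fwdDiff fun y => ?_
      have h1 := (ih (n + 1) (by omega) (hD.2 (transform (dirac y)))).smul (m.1 y)
      have h2 := (isGeneralizedPolynomial_const (G := G)
        (D (transform (dirac y)) m * m.1 y)).mono (k := n + 1 + 1) (by omega)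
      convert h1.add h2 using 1
      funext x
      simp only [fwdDiff, leibnizDefect, Pi.add_apply, Pi.smul_apply, smul_eq_mul,
        LinearMap.sub_apply, LinearMap.comp_apply, LinearMap.mulRight_apply,
        FourierAlgebra.sub_apply, FourierAlgebra.mul_apply, hdirac]
      rw [transform_dirac_add, AddChar.map_add_eq_mul]
      linear_combination (D (transform (dirac x)) m * m.1 x) * m.mul_neg_self y +
        (D (transform (dirac y)) m * m.1 y) * m.mul_neg_self x

end

noncomputable section
variable {G : Type*} [AddCommGroup G] [TopologicalSpace G] [IsTopologicalAddGroup G]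

/-! ### Multiplication of measures by polynomials -/

/-- If the transform of `μ` vanishes, then so does the transform of `a μ` for additive `a`: the
integral of `a m̌` is the derivative of the transform of `μ` along the exponentials
`m * exp (-t a)`. -/
theorem integral_mul_check_eq_zero {a : C(G, ℂ)} (ha : ∀ x y, a (x + y) = a x + a y)
    {μ : MeasureAlgebra G} (hμ : ∀ m : Exponential G, μ m.check = 0) (m : Exponential G) :
    μ (a * m.check) = 0 := by
  let φ : ℂ → ℂ := dslope Complex.exp 0
  have hφ : Continuous φ := by
    rw [← continuousOn_univ]
    exact (continuousOn_dslope Filter.univ_mem).2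
      ⟨Complex.continuous_exp.continuousOn, Complex.differentiable_exp 0⟩
  have hφ0 : φ 0 = 1 := by simp [φ, dslope_same]
  have hφm : ∀ z, z * φ z = Complex.exp z - 1 := fun z => by
    simpa using sub_smul_dslope Complex.exp 0 z
  have ha0 : a 0 = 0 := by simpa using ha 0 0
  have han : ∀ x, a (-x) = -a x := fun x => by
    have := ha x (-x)
    rw [add_neg_cancel, ha0] at this
    linear_combination -this
  -- `K t = (exp (t a) m̌ - m̌) / t`, extended continuously to `t = 0`
  let K : C(ℂ, C(G, ℂ)) := ContinuousMap.curry
    ⟨fun p : ℂ × G => a p.2 * φ (p.1 * a p.2) * m.check p.2, by fun_prop⟩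
  have hK0 : K 0 = a * m.check := by
    ext x
    change a x * φ (0 * a x) * m.check x = a x * m.check x
    rw [zero_mul, hφ0, mul_one]
  have hK : ∀ t, t ≠ 0 → μ (K t) = 0 := fun t ht => by
    let mt : Exponential G := ⟨
      { toFun := fun x => m.1 x * Complex.exp (-(t * a x))
        map_zero_eq_one' := by simp [ha0]
        map_add_eq_mul' := fun x y => by
          rw [AddChar.map_add_eq_mul, ha, mul_add, neg_add, Complex.exp_add]
          ring }, m.2.mul (by fun_prop)⟩
    have h1 : t • K t = mt.check - m.check := by
      ext x
      change t * (a x * φ (t * a x) * m.1 (-x)) =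
        m.1 (-x) * Complex.exp (-(t * a (-x))) - m.1 (-x)
      rw [han, mul_neg, neg_neg]
      linear_combination m.1 (-x) * hφm (t * a x)
    have h2 : t • μ (K t) = 0 := by
      rw [← map_smul, h1, map_sub, hμ, hμ, sub_zero]
    simpa [ht] using h2
  have hc : Continuous fun t => μ (K t) := (continuous_integral μ).comp K.continuous
  have h0 : (fun t => μ (K t)) = fun _ => 0 :=
    hc.ext_on (dense_compl_singleton (0 : ℂ)) continuous_const fun t ht => hK t ht
  rw [← hK0]
  exact congrFun h0 0

variable [LocallyCompactSpace G]

/-- The measure `g μ` with density `g` with respect to `μ`, as a function of `μ`. -/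
def mulMeasure {G : Type*} [TopologicalSpace G] [LocallyCompactSpace G]
    (g : C(G, ℂ)) : MeasureAlgebra G →ₗ[ℂ] MeasureAlgebra G where
  toFun μ :=
    { toFun := fun h => μ (g * h)
      map_add' := fun h k => by rw [mul_add, map_add]
      map_smul' := fun c h => by rw [mul_smul_comm, map_smul]; rfl
      cont := (continuous_integral μ).comp (continuous_const_mul g) }
  map_add' _ _ := rfl
  map_smul' _ _ := rfl

theorem mulMeasure_apply {G : Type*} [TopologicalSpace G] [LocallyCompactSpace G]
    (g h : C(G, ℂ)) (μ : MeasureAlgebra G) : mulMeasure g μ h = μ (g * h) := rfl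

theorem continuous_mulMeasure {G : Type*} [TopologicalSpace G] [LocallyCompactSpace G]
    (g : C(G, ℂ)) : Continuous (mulMeasure g) :=
  WeakDual.continuous_of_continuous_eval fun h => WeakDual.eval_continuous (g * h)

/-- Multiplication by a continuous additive function is a derivation of order one. -/
theorem exists_derivation_of_additive {a : C(G, ℂ)} (ha : ∀ x y, a (x + y) = a x + a y) :
    ∃ E : FourierAlgebra G →ₗ[ℂ] FourierAlgebra G, IsDerivationOfOrder 1 E ∧
      ∀ μ, E (transform μ) = transform (mulMeasure a μ) := by
  obtain ⟨s, hs⟩ := LinearMap.exists_rightInverse_of_surjective (transform (G := G))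
    (LinearMap.range_eq_top.2 transform_surjective)
  let E : FourierAlgebra G →ₗ[ℂ] FourierAlgebra G := transform ∘ₗ mulMeasure a ∘ₗ s
  have hE : ∀ μ, E (transform μ) = transform (mulMeasure a μ) := fun μ => by
    have h1 : transform (s (transform μ) - μ) = 0 := by
      rw [map_sub, sub_eq_zero]
      exact LinearMap.congr_fun hs (transform μ)
    have h2 : transform (mulMeasure a (s (transform μ) - μ)) = 0 :=
      FourierAlgebra.ext fun m => integral_mul_check_eq_zero (μ := s (transform μ) - μ) ha
        (fun m' => congrArg (evalAt m') h1) m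
    rw [map_sub, map_sub, sub_eq_zero] at h2
    exact h2
  refine ⟨E, ⟨?_, ?_⟩, hE⟩
  · refine continuous_coinduced_dom.2 ?_
    have : E ∘ transform = transform ∘ mulMeasure a := funext hE
    rw [this]
    exact continuous_transform.comp (continuous_mulMeasure a)
  · intro b c
    obtain ⟨μ, rfl⟩ := transform_surjective b
    obtain ⟨ν, rfl⟩ := transform_surjective c
    rw [← transform_conv, hE, hE, hE]
    refine FourierAlgebra.ext fun m => ?_
    change ν (innerIntegral μ (a * m.check)) =
      μ (a * m.check) * ν m.check + μ m.check * ν (a * m.check)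
    have : innerIntegral μ (a * m.check) =
        μ (a * m.check) • m.check + μ m.check • (a * m.check) := by
      ext y
      have : shifts (a * m.check) y = m.1 (-y) • (a * m.check) + (m.1 (-y) * a y) • m.check := by
        ext x
        change a (x + y) * m.1 (-(x + y)) =
          m.1 (-y) * (a x * m.1 (-x)) + m.1 (-y) * a y * m.1 (-x)
        rw [ha, neg_add, AddChar.map_add_eq_mul]
        ring
      change μ (shifts (a * m.check) y) =
        μ (a * m.check) * m.1 (-y) + μ m.check * (a y * m.1 (-y))
      rw [this, map_add, map_smul, map_smul, smul_eq_mul, smul_eq_mul]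
      ring
    rw [this, map_add, map_smul, map_smul, smul_eq_mul, smul_eq_mul]

/-- Multiplication of measures by a polynomial induces a polynomial derivation of `A(G)`. -/
theorem exists_polynomialDerivation_of_mem_polynomials {p : C(G, ℂ)} (hp : p ∈ polynomials G) :
    ∃ E ∈ polynomialDerivations G, ∀ μ, E (transform μ) = transform (mulMeasure p μ) := by
  induction hp using Algebra.adjoin_induction with
  | mem a ha =>
    obtain ⟨E, hE, h⟩ := exists_derivation_of_additive ha
    exact ⟨E, Algebra.subset_adjoin hE, h⟩
  | algebraMap c =>
    refine ⟨algebraMap ℂ _ c, Subalgebra.algebraMap_mem _ c, fun μ => ?_⟩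
    rw [Module.algebraMap_end_apply, ← map_smul]
    congr 1
    refine DFunLike.ext _ _ fun h => ?_
    rw [mulMeasure_apply, ← Algebra.smul_def, map_smul]
    rfl
  | add p q _ _ hp hq =>
    obtain ⟨E, hE, h⟩ := hp
    obtain ⟨F, hF, h'⟩ := hq
    refine ⟨E + F, Subalgebra.add_mem _ hE hF, fun μ => ?_⟩
    rw [LinearMap.add_apply, h, h', ← map_add]
    congr 1
    refine DFunLike.ext _ _ fun k => ?_
    rw [mulMeasure_apply, add_mul, map_add]
    rfl
  | mul p q _ _ hp hq =>
    obtain ⟨E, hE, h⟩ := hp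
    obtain ⟨F, hF, h'⟩ := hq
    refine ⟨E * F, Subalgebra.mul_mem _ hE hF, fun μ => ?_⟩
    rw [Module.End.mul_apply, h', h]
    congr 1
    refine DFunLike.ext _ _ fun k => ?_
    rw [mulMeasure_apply, mulMeasure_apply, mulMeasure_apply, mul_left_comm, mul_assoc]

/-- Under either assumption on `D`, its generating function at `m` is not a polynomial. -/
theorem generatingFunction_notMem_polynomials (D : FourierAlgebra G →L[ℂ] FourierAlgebra G)
    (hpoly : (D : FourierAlgebra G →ₗ[ℂ] FourierAlgebra G) ∉ polynomialDerivations G)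
    (m : Exponential G)
    (hm : (∀ m₁ m₂ : Exponential G, generatingFunction D m₁ = generatingFunction D m₂) ∨
      ∀ E ∈ polynomialDerivations G, ∃ a : FourierAlgebra G, E a m ≠ D a m) :
    generatingFunction D m ∉ polynomials G := by
  intro hp
  obtain ⟨E, hE, h⟩ := exists_polynomialDerivation_of_mem_polynomials hp
  rcases hm with hm | hm
  · refine hpoly ?_
    convert hE
    refine LinearMap.ext fun a => FourierAlgebra.ext fun m' => ?_
    obtain ⟨μ, rfl⟩ := transform_surjective a
    rw [h]
    change D (transform μ) m' = μ (generatingFunction D m * m'.check)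
    rw [apply_transform_eq_integral, hm m' m]
  · obtain ⟨a, ha⟩ := hm E hE
    obtain ⟨μ, rfl⟩ := transform_surjective a
    refine ha ?_
    rw [h, apply_transform_eq_integral]
    rfl

end

noncomputable section

/-! ### Separation of a vector from a closed subspace -/

theorem exists_dual_eq_one_of_notMem_closure {E : Type*} [AddCommGroup E] [Module ℂ E]
    [TopologicalSpace E] [IsTopologicalAddGroup E] [ContinuousSMul ℂ E] [Module ℝ E]
    [IsScalarTower ℝ ℂ E] [ContinuousSMul ℝ E] [LocallyConvexSpace ℝ E] {S : Submodule ℂ E} {x : E}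
    (hx : x ∉ S.topologicalClosure) :
    ∃ φ : E →L[ℂ] ℂ, (∀ s ∈ S, φ s = 0) ∧ φ x = 1 := by
  have hconv : Convex ℝ (S.topologicalClosure : Set E) :=
    (S.topologicalClosure.restrictScalars ℝ).convex
  obtain ⟨φ, u, hu, hux⟩ := RCLike.geometric_hahn_banach_closed_point (𝕜 := ℂ) hconv
    S.isClosed_topologicalClosure hx
  have hS : ∀ s ∈ S, φ s = 0 := by
    intro s hs
    by_contra h
    have h1 := hu (((u : ℂ) * (φ s)⁻¹) • s)
      (S.le_topologicalClosure (S.smul_mem _ hs))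
    rw [map_smul, smul_eq_mul, mul_assoc, inv_mul_cancel₀ h, mul_one] at h1
    simp at h1
  have hx0 : φ x ≠ 0 := by
    intro h
    have h1 := hu 0 (Submodule.zero_mem _)
    rw [map_zero] at h1
    rw [h] at hux
    exact lt_asymm h1 hux
  refine ⟨(φ x)⁻¹ • φ, fun s hs => ?_, ?_⟩
  · rw [smul_apply, hS s hs, smul_zero]
  · rw [smul_apply, smul_eq_mul, inv_mul_cancel₀ hx0]

variable {G : Type*} [AddCommGroup G] [TopologicalSpace G] [IsTopologicalAddGroup G]

/-! ### A Nakayama lemma for generalized polynomials -/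

/-- The span of the differences of `f` of order at least `k`. -/
def diffSpan (f : C(G, ℂ)) (k : ℕ) : Submodule ℂ C(G, ℂ) :=
  Submodule.span ℂ {g | ∃ ys : List G, k ≤ ys.length ∧ diffs ys f = g}

theorem diffs_mem_diffSpan (f : C(G, ℂ)) {k : ℕ} {ys : List G} (h : k ≤ ys.length) :
    diffs ys f ∈ diffSpan f k := Submodule.subset_span ⟨ys, h, rfl⟩

/-- The line of the constant functions. -/
def constants (G : Type*) [TopologicalSpace G] : Submodule ℂ C(G, ℂ) := Submodule.span ℂ {1}

theorem one_mem_constants {G : Type*} [TopologicalSpace G] :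
    (1 : C(G, ℂ)) ∈ constants G := Submodule.mem_span_singleton_self 1

theorem translationInvariant_constants : TranslationInvariant (constants G) := by
  intro y f hf
  obtain ⟨c, rfl⟩ := Submodule.mem_span_singleton.1 hf
  exact Submodule.mem_span_singleton.2 ⟨c, rfl⟩

instance : FiniteDimensional ℂ (constants G) :=
  FiniteDimensional.span_of_finite ℂ (Set.finite_singleton _)

theorem diffs_mem_closure_of_mem_closure {f g : C(G, ℂ)} {U : Submodule ℂ C(G, ℂ)}
    (hU : TranslationInvariant U) {k : ℕ} (hg : g ∈ (diffSpan f k ⊔ U).topologicalClosure)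
    (ys : List G) : diffs ys g ∈ (diffSpan f (ys.length + k) ⊔ U).topologicalClosure := by
  have h1 : diffSpan f k ⊔ U ≤
      (diffSpan f (ys.length + k) ⊔ U).topologicalClosure.comap (diffs ys).toLinearMap := by
    refine sup_le (Submodule.span_le.2 ?_) fun u hu => ?_
    · rintro _ ⟨zs, hzs, rfl⟩
      refine Submodule.le_topologicalClosure _ (Submodule.mem_sup_left ?_)
      change diffs ys (diffs zs f) ∈ _
      rw [← diffs_append]
      exact diffs_mem_diffSpan f (by simpa using hzs)
    · exact Submodule.le_topologicalClosure _ (Submodule.mem_sup_right (hU.diffs_mem ys hu))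
  exact Submodule.topologicalClosure_minimal _ h1
    ((Submodule.isClosed_topologicalClosure _).preimage (diffs ys).continuous) hg

/-- If a generalized polynomial `f` lies in the closure of the sum of the span of its differences
and a finite dimensional translation invariant space `U`, then it lies in `U`: differences of order
`k` then lie in the closure of the sum of `U` and the differences of order `k + 1`, and differences
of high order vanish. -/
theorem IsGeneralizedPolynomial.mem_of_mem_closure {n : ℕ} {f : C(G, ℂ)}
    (hf : IsGeneralizedPolynomial n f) {U : Submodule ℂ C(G, ℂ)} [FiniteDimensional ℂ U]
    (hU : TranslationInvariant U) (h : f ∈ (diffSpan f 1 ⊔ U).topologicalClosure) : f ∈ U := by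
  have key : ∀ k, f ∈ (diffSpan f (k + 1) ⊔ U).topologicalClosure := by
    intro k
    induction k with
    | zero => exact h
    | succ k ih =>
      refine Submodule.topologicalClosure_minimal _ ?_ (Submodule.isClosed_topologicalClosure _) ih
      refine sup_le (Submodule.span_le.2 ?_)
        (le_sup_right.trans (Submodule.le_topologicalClosure _))
      rintro _ ⟨ys, hys, rfl⟩
      refine Submodule.topologicalClosure_mono (sup_le_sup_right ?_ U)
        (diffs_mem_closure_of_mem_closure hU h ys)
      refine Submodule.span_mono ?_
      rintro _ ⟨zs, hzs, rfl⟩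
      exact ⟨zs, by omega, rfl⟩
  have hbot : diffSpan f (n + 1) = ⊥ := by
    refine Submodule.span_eq_bot.2 ?_
    rintro _ ⟨ys, hys, rfl⟩
    exact hf.diffs_eq_zero (by omega)
  have h1 := key n
  rw [hbot, bot_sup_eq] at h1
  have hc : IsClosed (U : Set C(G, ℂ)) := Submodule.closed_of_finiteDimensional U
  rwa [hc.submodule_topologicalClosure_eq] at h1

/-- If the generalized polynomial `f` is not a polynomial, then some functional `φ` with `φ f = 1`
vanishes on the constants, on the differences of `f`, and on every finite dimensional translation
invariant subspace of the variety generated by `f` and the constants. -/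
theorem IsGeneralizedPolynomial.exists_functional {n : ℕ} {f : C(G, ℂ)}
    (hf : IsGeneralizedPolynomial n f) (hp : f ∉ polynomials G) :
    ∃ φ : C(G, ℂ) →L[ℂ] ℂ, φ f = 1 ∧
      ∀ U : Submodule ℂ C(G, ℂ), FiniteDimensional ℂ U → TranslationInvariant U →
        U ≤ (translateSpan f ⊔ constants G).topologicalClosure → ∀ u ∈ U, φ u = 0 := by
  have h0 : f ∉ (diffSpan f 1 ⊔ constants G).topologicalClosure := fun h =>
    hp (hf.mem_polynomials translationInvariant_constants
      (hf.mem_of_mem_closure translationInvariant_constants h))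
  obtain ⟨φ, hφ, hφf⟩ := exists_dual_eq_one_of_notMem_closure h0
  refine ⟨φ, hφf, fun U hfin hU hUW u hu => ?_⟩
  -- `w - φ w • f` lies in the closure of the span of the differences and the constants
  have h1 : translateSpan f ⊔ constants G ≤ (diffSpan f 1 ⊔ constants G).topologicalClosure.comap
      (ContinuousLinearMap.id ℂ C(G, ℂ) - φ.smulRight f).toLinearMap := by
    refine sup_le (Submodule.span_le.2 ?_) (Submodule.span_le.2 ?_)
    · rintro _ ⟨y, rfl⟩
      have hd : diffs [y] f ∈ diffSpan f 1 ⊔ constants G :=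
        Submodule.mem_sup_left (diffs_mem_diffSpan f (by simp))
      have hφy : φ (translate y f) = 1 := by
        have := hφ _ hd
        rw [diffs_cons, diffs_nil, map_sub, hφf, sub_eq_zero] at this
        exact this
      change translate y f - φ (translate y f) • f ∈
        (diffSpan f 1 ⊔ constants G).topologicalClosure
      rw [hφy, one_smul]
      exact Submodule.le_topologicalClosure _ hd
    · rintro _ rfl
      have hd : (1 : C(G, ℂ)) ∈ diffSpan f 1 ⊔ constants G :=
        Submodule.mem_sup_right one_mem_constants
      change 1 - φ 1 • f ∈ (diffSpan f 1 ⊔ constants G).topologicalClosure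
      have h1 : φ 1 • f = 0 := by rw [hφ _ hd]; exact zero_smul ℂ f
      rw [h1, sub_zero]
      exact Submodule.le_topologicalClosure _ hd
  have h2 : u - φ u • f ∈ (diffSpan f 1 ⊔ constants G).topologicalClosure :=
    Submodule.topologicalClosure_minimal _ h1
      ((Submodule.isClosed_topologicalClosure _).preimage
        (ContinuousLinearMap.id ℂ C(G, ℂ) - φ.smulRight f).continuous) (hUW hu)
  by_contra hne
  have hinv := translationInvariant_constants.sup hU
  have hfin' : FiniteDimensional ℂ ↥(constants G ⊔ U) := Submodule.finiteDimensional_sup _ _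
  refine hp (hf.mem_polynomials hinv (hf.mem_of_mem_closure hinv ?_))
  have h3 : diffSpan f 1 ⊔ constants G ≤ diffSpan f 1 ⊔ (constants G ⊔ U) :=
    sup_le_sup_left le_sup_left _
  have h4 : u ∈ (diffSpan f 1 ⊔ (constants G ⊔ U)).topologicalClosure :=
    Submodule.le_topologicalClosure _ (Submodule.mem_sup_right (Submodule.mem_sup_right hu))
  have h5 := Submodule.smul_mem _ (φ u)⁻¹
    (Submodule.sub_mem _ h4 (Submodule.topologicalClosure_mono h3 h2))
  rwa [sub_sub_cancel, smul_smul, inv_mul_cancel₀ hne, one_smul] at h5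

end

noncomputable section
variable {G : Type*} [AddCommGroup G] [TopologicalSpace G] [IsTopologicalAddGroup G]

/-! ### Ideals orthogonal to a translation invariant space -/

/-- The measures `μ` with `∫ w m̌ dμ = 0` for all `w` in `W`. -/
def orthogonalMeasures (W : Submodule ℂ C(G, ℂ)) (m : Exponential G) :
    Submodule ℂ (MeasureAlgebra G) where
  carrier := {μ | ∀ w ∈ W, μ (w * m.check) = 0}
  zero_mem' := fun _ _ => rfl
  add_mem' := fun {μ ν} hμ hν w hw => by
    change μ (w * m.check) + ν (w * m.check) = 0
    rw [hμ w hw, hν w hw, add_zero]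
  smul_mem' := fun c μ hμ w hw => by
    change c * μ (w * m.check) = 0
    rw [hμ w hw, mul_zero]

theorem mem_orthogonalMeasures {W : Submodule ℂ C(G, ℂ)} {m : Exponential G}
    {μ : MeasureAlgebra G} :
    μ ∈ orthogonalMeasures W m ↔ ∀ w ∈ W, μ (w * m.check) = 0 := Iff.rfl

theorem shifts_mul_check (w : C(G, ℂ)) (m : Exponential G) (y : G) :
    shifts (w * m.check) y = m.1 (-y) • (translate y w * m.check) := by
  ext x
  change w (x + y) * m.1 (-(x + y)) = m.1 (-y) * (w (x + y) * m.1 (-x))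
  rw [neg_add, AddChar.map_add_eq_mul]
  ring

theorem innerIntegral_mul_check (μ : MeasureAlgebra G) (w : C(G, ℂ)) (m : Exponential G) (y : G) :
    innerIntegral μ (w * m.check) y = m.1 (-y) * μ (translate y w * m.check) := by
  change μ (shifts (w * m.check) y) = _
  rw [shifts_mul_check, map_smul, smul_eq_mul]

theorem isClosed_orthogonalMeasures (W : Submodule ℂ C(G, ℂ)) (m : Exponential G) :
    IsClosed (orthogonalMeasures W m : Set (MeasureAlgebra G)) := by
  have : (orthogonalMeasures W m : Set (MeasureAlgebra G)) =
      ⋂ w ∈ W, {μ | μ (w * m.check) = 0} := by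
    ext μ
    simp [mem_orthogonalMeasures]
  rw [this]
  exact isClosed_biInter fun w _ =>
    isClosed_eq (WeakDual.eval_continuous (w * m.check)) continuous_const

variable [LocallyCompactSpace G]

theorem conv_mem_orthogonalMeasures {W : Submodule ℂ C(G, ℂ)} (hW : TranslationInvariant W)
    {m : Exponential G} {μ : MeasureAlgebra G} (hμ : μ ∈ orthogonalMeasures W m)
    (ν : MeasureAlgebra G) : conv μ ν ∈ orthogonalMeasures W m := by
  intro w hw
  have : innerIntegral μ (w * m.check) = 0 := by
    ext y
    rw [innerIntegral_mul_check, hμ _ (hW y w hw), mul_zero]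
    rfl
  change ν (innerIntegral μ (w * m.check)) = 0
  rw [this, map_zero]

/-- The ideal of the transforms of the measures orthogonal to `W m̌`. -/
def orthogonalIdeal {W : Submodule ℂ C(G, ℂ)} (hW : TranslationInvariant W) (m : Exponential G) :
    Ideal (FourierAlgebra G) where
  carrier := transform '' (orthogonalMeasures W m : Set (MeasureAlgebra G))
  zero_mem' := ⟨0, Submodule.zero_mem _, map_zero _⟩
  add_mem' := by
    rintro _ _ ⟨μ, hμ, rfl⟩ ⟨ν, hν, rfl⟩
    exact ⟨μ + ν, Submodule.add_mem _ hμ hν, map_add _ _ _⟩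
  smul_mem' := by
    rintro c _ ⟨μ, hμ, rfl⟩
    obtain ⟨ν, rfl⟩ := transform_surjective c
    exact ⟨conv μ ν, conv_mem_orthogonalMeasures hW hμ ν, by
      rw [transform_conv, smul_eq_mul, mul_comm]⟩

theorem transform_mem_orthogonalIdeal {W : Submodule ℂ C(G, ℂ)} {hW : TranslationInvariant W}
    {m : Exponential G} (hker : LinearMap.ker (transform (G := G)) ≤ orthogonalMeasures W m)
    {μ : MeasureAlgebra G} :
    transform μ ∈ orthogonalIdeal hW m ↔ μ ∈ orthogonalMeasures W m := by
  refine ⟨?_, fun h => ⟨μ, h, rfl⟩⟩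
  rintro ⟨ν, hν, h⟩
  have h1 : μ - ν ∈ orthogonalMeasures W m := hker (by rw [LinearMap.mem_ker, map_sub, h, sub_self])
  simpa using Submodule.add_mem _ h1 hν

theorem isClosed_orthogonalIdeal {W : Submodule ℂ C(G, ℂ)} (hW : TranslationInvariant W)
    {m : Exponential G} (hker : LinearMap.ker (transform (G := G)) ≤ orthogonalMeasures W m) :
    IsClosed (orthogonalIdeal hW m : Set (FourierAlgebra G)) := by
  refine isClosed_coinduced.2 ?_
  convert isClosed_orthogonalMeasures W m using 1
  ext μ
  exact transform_mem_orthogonalIdeal hker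

/-- A measure whose functional is `h ↦ φ (h m)`; its integral against `w m̌` is `φ w`. -/
theorem exists_measure_integral_mul_check (φ : C(G, ℂ) →L[ℂ] ℂ) (m : Exponential G) :
    ∃ ν : MeasureAlgebra G, ∀ w, ν (w * m.check) = φ w := by
  let φ' : MeasureAlgebra G := StrongDual.toWeakDual φ
  refine ⟨mulMeasure m.toContinuousMap φ', fun w => ?_⟩
  rw [mulMeasure_apply, mul_left_comm, m.toContinuousMap_mul_check, mul_one]
  rfl

/-- The bipolar theorem: the closure of `W` is determined by the measures orthogonal to `W m̌`. -/
theorem mem_closure_of_orthogonal {W : Submodule ℂ C(G, ℂ)} {m : Exponential G} {w : C(G, ℂ)}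
    (h : ∀ μ ∈ orthogonalMeasures W m, μ (w * m.check) = 0) : w ∈ W.topologicalClosure := by
  by_contra hw
  obtain ⟨φ, hφ, hφw⟩ := exists_dual_eq_one_of_notMem_closure hw
  obtain ⟨ν, hν⟩ := exists_measure_integral_mul_check φ m
  have h1 := h ν fun w hw => by rw [hν, hφ w hw]
  rw [hν, hφw] at h1
  exact one_ne_zero h1

/-! ### Annihilators -/

theorem mem_annihilator {I : Ideal (FourierAlgebra G)} {f : C(G, ℂ)} :
    f ∈ annihilator I ↔ ∀ μ : MeasureAlgebra G, transform μ ∈ I → convFun μ f = 0 := by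
  simp [annihilator, Submodule.mem_iInf]

theorem isVariety_annihilator (I : Ideal (FourierAlgebra G)) : IsVariety (annihilator I) := by
  constructor
  · have : (annihilator I : Set C(G, ℂ)) = ⋂ (μ : MeasureAlgebra G) (_ : transform μ ∈ I) (x : G),
        {f | μ (f.comp ⟨fun y => x - y, by fun_prop⟩) = 0} := by
      ext f
      simp only [SetLike.mem_coe, mem_annihilator, Set.mem_iInter]
      exact forall₂_congr fun μ _ => DFunLike.ext_iff
    rw [this]
    exact isClosed_iInter fun μ => isClosed_iInter fun _ => isClosed_iInter fun x =>
      isClosed_eq ((continuous_integral μ).comp (ContinuousMap.continuous_precomp _))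
        continuous_const
  · intro f hf y
    rw [mem_annihilator] at hf ⊢
    intro μ hμ
    ext x
    have h1 : (f.comp ⟨fun x => x + y, by fun_prop⟩ : C(G, ℂ)).comp
        ⟨fun z => x - z, by fun_prop⟩ = f.comp ⟨fun z => x + y - z, by fun_prop⟩ := by
      ext z
      change f (x - z + y) = f (x + y - z)
      rw [sub_add_eq_add_sub]
    change μ ((f.comp ⟨fun x => x + y, by fun_prop⟩ : C(G, ℂ)).comp
        ⟨fun z => x - z, by fun_prop⟩) = 0
    rw [h1]
    exact DFunLike.congr_fun (hf μ hμ) (x + y)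

/-- The involution `g ↦ ǧ m` of `C(G)`, where `ǧ(x) = g(-x)`. -/
def reflect (m : Exponential G) : C(G, ℂ) →L[ℂ] C(G, ℂ) where
  toFun g := g.comp ⟨fun x => -x, by fun_prop⟩ * m.toContinuousMap
  map_add' f g := by rw [ContinuousMap.add_comp, add_mul]
  map_smul' c g := by rw [ContinuousMap.smul_comp, smul_mul_assoc]; rfl
  cont := (ContinuousMap.continuous_precomp _).mul continuous_const

theorem reflect_apply (m : Exponential G) (g : C(G, ℂ)) (x : G) :
    reflect m g x = g (-x) * m.1 x := rfl

theorem reflect_reflect (m : Exponential G) (g : C(G, ℂ)) : reflect m (reflect m g) = g := by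
  ext x
  rw [reflect_apply, reflect_apply, neg_neg, mul_assoc, mul_comm (m.1 (-x)), m.mul_neg_self,
    mul_one]

theorem translate_reflect (m : Exponential G) (g : C(G, ℂ)) (y : G) :
    translate y (reflect m g) = m.1 y • reflect m (translate (-y) g) := by
  ext x
  change g (-(x + y)) * m.1 (x + y) = m.1 y * (g (-x + -y) * m.1 x)
  rw [neg_add, AddChar.map_add_eq_mul]
  ring

theorem convFun_reflect (m : Exponential G) (μ : MeasureAlgebra G) (w : C(G, ℂ)) (x : G) :
    convFun μ (reflect m w) x = m.1 x * μ (translate (-x) w * m.check) := by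
  change μ ((reflect m w).comp ⟨fun y => x - y, by fun_prop⟩) = _
  have : (reflect m w).comp ⟨fun y => x - y, by fun_prop⟩ =
      m.1 x • (translate (-x) w * m.check) := by
    ext y
    change w (-(x - y)) * m.1 (x - y) = m.1 x * (w (y + -x) * m.1 (-y))
    rw [sub_eq_add_neg, AddChar.map_add_eq_mul, neg_add, neg_neg, add_comm (-x)]
    ring
  rw [this, map_smul, smul_eq_mul]

theorem convFun_apply_zero (m : Exponential G) (μ : MeasureAlgebra G) (g : C(G, ℂ)) :
    convFun μ g 0 = μ (reflect m g * m.check) := by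
  have h := convFun_reflect m μ (reflect m g) 0
  rw [reflect_reflect, AddChar.map_zero_eq_one, one_mul, neg_zero] at h
  rw [h]
  congr 2
  ext x
  simp

theorem reflect_mem_annihilator {W : Submodule ℂ C(G, ℂ)} (hW : TranslationInvariant W)
    {m : Exponential G} (hker : LinearMap.ker (transform (G := G)) ≤ orthogonalMeasures W m)
    {w : C(G, ℂ)} (hw : w ∈ W) :
    reflect m w ∈ annihilator (orthogonalIdeal hW m) := by
  rw [mem_annihilator]
  intro μ hμ
  rw [transform_mem_orthogonalIdeal hker] at hμ
  ext x
  rw [convFun_reflect, hμ _ (hW _ w hw), mul_zero]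
  rfl

theorem reflect_mem_closure {W : Submodule ℂ C(G, ℂ)} (hW : TranslationInvariant W)
    {m : Exponential G} (hker : LinearMap.ker (transform (G := G)) ≤ orthogonalMeasures W m)
    {g : C(G, ℂ)} (hg : g ∈ annihilator (orthogonalIdeal hW m)) :
    reflect m g ∈ W.topologicalClosure := by
  rw [mem_annihilator] at hg
  refine mem_closure_of_orthogonal (m := m) fun μ hμ => ?_
  rw [← convFun_apply_zero, hg μ ((transform_mem_orthogonalIdeal hker).2 hμ)]
  rfl

theorem transform_mem_iff_forall_annihilator {W : Submodule ℂ C(G, ℂ)} (hW : TranslationInvariant W)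
    {m : Exponential G} (hker : LinearMap.ker (transform (G := G)) ≤ orthogonalMeasures W m)
    (μ : MeasureAlgebra G) :
    transform μ ∈ orthogonalIdeal hW m ↔
      ∀ f ∈ annihilator (orthogonalIdeal hW m), convFun μ f = 0 := by
  refine ⟨fun hμ f hf => mem_annihilator.1 hf μ hμ, fun h => ?_⟩
  rw [transform_mem_orthogonalIdeal hker]
  intro w hw
  have h1 := DFunLike.congr_fun (h _ (reflect_mem_annihilator hW hker hw)) 0
  rw [convFun_apply_zero m, reflect_reflect] at h1
  exact h1

end

noncomputable section
variable {G : Type*} [AddCommGroup G] [TopologicalSpace G] [IsTopologicalAddGroup G]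

/-! ### The ideal of a derivation -/

theorem TranslationInvariant.topologicalClosure {W : Submodule ℂ C(G, ℂ)}
    (hW : TranslationInvariant W) : TranslationInvariant W.topologicalClosure := by
  intro y f hf
  have h1 : W ≤ W.topologicalClosure.comap (translate y).toLinearMap := fun w hw =>
    W.le_topologicalClosure (hW y w hw)
  exact Submodule.topologicalClosure_minimal _ h1
    (W.isClosed_topologicalClosure.preimage (translate y).continuous) hf

/-- The translation invariant space generated by `f` and the constants. -/
def translateSpanConst (f : C(G, ℂ)) : Submodule ℂ C(G, ℂ) := translateSpan f ⊔ constants G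

theorem translationInvariant_translateSpanConst (f : C(G, ℂ)) :
    TranslationInvariant (translateSpanConst f) :=
  (translationInvariant_translateSpan f).sup translationInvariant_constants

theorem self_mem_translateSpanConst (f : C(G, ℂ)) : f ∈ translateSpanConst f :=
  Submodule.mem_sup_left (self_mem_translateSpan f)

theorem translateSpanConst_le {f : C(G, ℂ)} {S : Submodule ℂ C(G, ℂ)}
    (h : ∀ y, translate y f ∈ S) (h1 : 1 ∈ S) : translateSpanConst f ≤ S := by
  refine sup_le (Submodule.span_le.2 ?_) (Submodule.span_le.2 ?_)
  · rintro _ ⟨y, rfl⟩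
    exact h y
  · rintro _ rfl
    exact h1

theorem IsGeneralizedPolynomial.diffs_eq_zero_of_mem_closure {n : ℕ} {f : C(G, ℂ)}
    (hf : IsGeneralizedPolynomial n f) {w : C(G, ℂ)}
    (hw : w ∈ (translateSpanConst f).topologicalClosure) {ys : List G} (hys : n + 1 ≤ ys.length) :
    diffs ys w = 0 := by
  have h1 : translateSpanConst f ≤ LinearMap.ker (diffs ys).toLinearMap := by
    refine translateSpanConst_le (fun y => ?_) ?_
    · change diffs ys (translate y f) = 0
      rw [diffs_translate, hf.diffs_eq_zero (by omega), map_zero]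
    · have h : IsGeneralizedPolynomial 1 ((1 : C(G, ℂ)) : G → ℂ) := isGeneralizedPolynomial_const 1
      exact h.diffs_eq_zero (by omega)
  exact Submodule.topologicalClosure_minimal _ h1 (diffs ys).isClosed_ker hw

/-- The functions `w` with `∫ w m̌ dμ = 0`. -/
def orthogonalFunctions (μ : MeasureAlgebra G) (m : Exponential G) : Submodule ℂ C(G, ℂ) where
  carrier := {w | μ (w * m.check) = 0}
  zero_mem' := by simp
  add_mem' := fun {v w} hv hw => by
    change μ ((v + w) * m.check) = 0
    rw [add_mul, map_add, hv, hw, add_zero]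
  smul_mem' := fun c w hw => by
    change μ (c • w * m.check) = 0
    rw [smul_mul_assoc, map_smul, hw, smul_zero]

theorem diffAtZero_eq (f : C(G, ℂ)) (m : Exponential G) (ys : List G) :
    diffAtZero f m ys = diffs ys f * m.check - (diffs ys f 0) • m.check := by
  ext x
  change (iterDiff ys f (0 + x) - iterDiff ys f 0) * m.1 (-x) =
    diffs ys f x * m.1 (-x) - diffs ys f 0 * m.1 (-x)
  rw [coe_diffs, zero_add, sub_mul]

variable [LocallyCompactSpace G]

/-- Whether `μ` is orthogonal to the products of `m̌` with the translates of the generating function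
and with the constants depends on the transform of `μ` only, since translating the generating
function amounts to replacing `μ` by a translate of `μ`. -/
theorem ker_transform_le_orthogonalMeasures (D : FourierAlgebra G →L[ℂ] FourierAlgebra G)
    (m : Exponential G) : LinearMap.ker (transform (G := G)) ≤
      orthogonalMeasures (translateSpanConst (generatingFunction D m)) m := by
  intro μ hμ
  rw [LinearMap.mem_ker] at hμ
  refine translateSpanConst_le (S := orthogonalFunctions μ m) (fun y => ?_) ?_
  · have h1 : D (transform (conv μ (dirac y))) m = 0 := by
      rw [transform_conv, hμ, zero_mul, map_zero]
      rfl
    rw [apply_transform_eq_integral] at h1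
    change innerIntegral μ (generatingFunction D m * m.check) y = 0 at h1
    rw [innerIntegral_mul_check] at h1
    refine (mul_eq_zero.1 h1).resolve_left fun h => ?_
    have := m.mul_neg_self y
    rw [h, mul_zero] at this
    exact zero_ne_one this
  · change μ (1 * m.check) = 0
    rw [one_mul]
    exact congrArg (evalAt m) hμ

/-- The set `Î_{D,m}` consists of the transforms of the measures that are orthogonal to the
products of `m̌` with the translates of the generating function and with the constants. -/
theorem coe_orthogonalIdeal_eq_derivationIdeal (D : FourierAlgebra G →L[ℂ] FourierAlgebra G)
    (m : Exponential G) :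
    (orthogonalIdeal (translationInvariant_translateSpanConst (generatingFunction D m)) m :
      Set (FourierAlgebra G)) = derivationIdeal D m := by
  set f := generatingFunction D m with hf
  ext a
  constructor
  · rintro ⟨μ, hμ, rfl⟩
    have h1 : μ m.check = 0 := by
      simpa using hμ 1 (Submodule.mem_sup_right one_mem_constants)
    refine ⟨μ, rfl, ?_, h1, fun ys _ => ?_⟩
    · rw [apply_transform_eq_integral]
      exact hμ f (self_mem_translateSpanConst f)
    · rw [diffAtZero_eq, map_sub, map_smul, h1, smul_zero, sub_zero]
      exact hμ _ ((translationInvariant_translateSpanConst f).diffs_mem ys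
        (self_mem_translateSpanConst f))
  · rintro ⟨μ, rfl, h1, h2, h3⟩
    rw [apply_transform_eq_integral] at h1
    change μ m.check = 0 at h2
    refine ⟨μ, ?_, rfl⟩
    refine translateSpanConst_le (S := orthogonalFunctions μ m) (fun y => ?_) ?_
    · have h4 := h3 [y] (by simp)
      rw [diffAtZero_eq, map_sub, map_smul, h2, smul_zero, sub_zero, diffs_cons, diffs_nil,
        sub_mul, map_sub, h1, sub_zero] at h4
      exact h4
    · change μ (1 * m.check) = 0
      rw [one_mul, h2]

/-- The ideal has no zero besides `m`: an exponential `m'` in the zero set gives an exponential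
`m̌' m` that is a generalized polynomial, hence is constant. -/
theorem eq_of_mem_zeroSet {n : ℕ} {f : C(G, ℂ)} (hf : IsGeneralizedPolynomial n f)
    {m m' : Exponential G}
    (h : m' ∈ zeroSet (orthogonalIdeal (translationInvariant_translateSpanConst f) m)) :
    m' = m := by
  let w : C(G, ℂ) := m'.check * m.toContinuousMap
  have hw : w ∈ (translateSpanConst f).topologicalClosure := by
    refine mem_closure_of_orthogonal (m := m) fun μ hμ => ?_
    simp only [w]
    rw [mul_assoc, m.toContinuousMap_mul_check, mul_one]
    exact h _ ⟨μ, hμ, rfl⟩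
  refine Subtype.ext (DFunLike.ext _ _ fun y => ?_)
  set c := m'.1 (-y) * m.1 y with hc
  have htr : translate y w = c • w := by
    ext x
    change m'.1 (-(x + y)) * m.1 (x + y) = m'.1 (-y) * m.1 y * (m'.1 (-x) * m.1 x)
    rw [neg_add, AddChar.map_add_eq_mul, AddChar.map_add_eq_mul]
    ring
  have hpow : ∀ k : ℕ, diffs (List.replicate k y) w = (c - 1) ^ k • w := by
    intro k
    induction k with
    | zero => rw [pow_zero, one_smul]; rfl
    | succ k ih =>
      rw [List.replicate_succ, diffs_cons, ih, map_smul, htr]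
      ext x
      change (c - 1) ^ k * (c * w x) - (c - 1) ^ k * w x = (c - 1) ^ (k + 1) * w x
      ring
  have h0 := hf.diffs_eq_zero_of_mem_closure hw (ys := List.replicate (n + 1) y) (by simp)
  rw [hpow] at h0
  have h1 : (c - 1) ^ (n + 1) * (m'.1 (-0) * m.1 0) = 0 := DFunLike.congr_fun h0 0
  rw [neg_zero, AddChar.map_zero_eq_one, AddChar.map_zero_eq_one, mul_one, mul_one] at h1
  have h2 : c = 1 := sub_eq_zero.1 (pow_eq_zero_iff (Nat.succ_ne_zero n) |>.1 h1)
  linear_combination (-m'.1 y) * h2 + (-m'.1 y) * hc + m.1 y * m'.mul_neg_self y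

/-- The witness is the measure `ν` with `∫ w m̌ dν = φ w`, where `φ` is the functional of
`IsGeneralizedPolynomial.exists_functional`: a polynomial derivation `E` annihilating the ideal at
`m` has its generating function `e` in a finite dimensional translation invariant subspace of the
closure of the space generated by `f` and the constants, so that `E(ν̂)(m) = φ e = 0`. -/
theorem nonLocalizable_orthogonalIdeal {n : ℕ} {f : C(G, ℂ)} (hf : IsGeneralizedPolynomial n f)
    (hp : f ∉ polynomials G) {m : Exponential G}
    (hker : LinearMap.ker (transform (G := G)) ≤ orthogonalMeasures (translateSpanConst f) m) :
    NonLocalizable (orthogonalIdeal (translationInvariant_translateSpanConst f) m) := by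
  obtain ⟨φ, hφf, hφ⟩ := hf.exists_functional hp
  obtain ⟨ν, hν⟩ := exists_measure_integral_mul_check φ m
  refine ⟨transform ν, fun h => ?_, fun m' hm' E hE => ?_⟩
  · rw [transform_mem_orthogonalIdeal hker] at h
    have h1 := h f (self_mem_translateSpanConst f)
    rw [hν, hφf] at h1
    exact one_ne_zero h1
  · obtain rfl := eq_of_mem_zeroSet hf hm'
    let E' : FourierAlgebra G →L[ℂ] FourierAlgebra G :=
      ⟨E, continuous_of_mem_polynomialDerivations hE.1⟩
    have he : generatingFunction E' m' ∈ (translateSpanConst f).topologicalClosure := by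
      refine mem_closure_of_orthogonal (m := m') fun μ hμ => ?_
      rw [← apply_transform_eq_integral]
      exact hE.2 _ ⟨μ, hμ, rfl⟩
    change E' (transform ν) m' = 0
    rw [apply_transform_eq_integral, hν]
    exact hφ _ (finiteDimensional_translateSpan_generatingFunction E' hE.1 m')
      (translationInvariant_translateSpan _)
      (translateSpan_le (translationInvariant_translateSpanConst f).topologicalClosure he) _
      (self_mem_translateSpan _)

/-- The functional of `IsGeneralizedPolynomial.exists_functional`, composed with the involution
`reflect m`, vanishes on all finite dimensional subvarieties, but not at `reflect m f`. -/
theorem not_synthesizable_annihilator {n : ℕ} {f : C(G, ℂ)} (hf : IsGeneralizedPolynomial n f)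
    (hp : f ∉ polynomials G) {m : Exponential G}
    (hker : LinearMap.ker (transform (G := G)) ≤ orthogonalMeasures (translateSpanConst f) m) :
    ¬ Synthesizable
      (annihilator (orthogonalIdeal (translationInvariant_translateSpanConst f) m)) := by
  obtain ⟨φ, hφf, hφ⟩ := hf.exists_functional hp
  intro hs
  have h1 : sSup {U : Submodule ℂ C(G, ℂ) | IsVariety U ∧ FiniteDimensional ℂ U ∧
      U ≤ annihilator (orthogonalIdeal (translationInvariant_translateSpanConst f) m)} ≤
      LinearMap.ker (φ.comp (reflect m)).toLinearMap := by
    refine sSup_le ?_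
    rintro U ⟨hU, hfin, hUV⟩ u hu
    have hfin' : FiniteDimensional ℂ (U.map (reflect m).toLinearMap) :=
      Module.Finite.map U (reflect m).toLinearMap
    refine hφ (U.map (reflect m).toLinearMap) hfin' ?_ ?_ _ ⟨u, hu, rfl⟩
    · rintro y _ ⟨g, hg, rfl⟩
      change translate y (reflect m g) ∈ _
      rw [translate_reflect]
      exact Submodule.smul_mem _ _ ⟨_, hU.2 g hg (-y), rfl⟩
    · rintro _ ⟨g, hg, rfl⟩
      exact reflect_mem_closure _ hker (hUV hg)
  have h2 := hs.trans (Submodule.topologicalClosure_minimal _ h1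
    (φ.comp (reflect m)).isClosed_ker)
  have h3 : φ (reflect m (reflect m f)) = 0 :=
    h2 (reflect_mem_annihilator _ hker (self_mem_translateSpanConst f))
  rw [reflect_reflect, hφf] at h3
  exact one_ne_zero h3

end
end SpectralSynthesis

open SpectralSynthesis in
theorem mainTheorem6 {G : Type*} [AddCommGroup G] [TopologicalSpace G] [IsTopologicalAddGroup G]
    [LocallyCompactSpace G] [T2Space G]
    (D : FourierAlgebra G →L[ℂ] FourierAlgebra G)
    (hD : IsDerivation (D : FourierAlgebra G →ₗ[ℂ] FourierAlgebra G))
    (hpoly : (D : FourierAlgebra G →ₗ[ℂ] FourierAlgebra G) ∉ polynomialDerivations G)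
    (m : Exponential G)
    (hm : (∀ m₁ m₂ : Exponential G, generatingFunction D m₁ = generatingFunction D m₂) ∨
      ∀ E ∈ polynomialDerivations G, ∃ a : FourierAlgebra G, E a m ≠ D a m) :
    ∃ I : Ideal (FourierAlgebra G), (I : Set (FourierAlgebra G)) = derivationIdeal D m ∧
      IsClosed (I : Set (FourierAlgebra G)) ∧ NonLocalizable I ∧
      IsVariety (annihilator I) ∧
      (∀ μ : MeasureAlgebra G, transform μ ∈ I ↔ ∀ f ∈ annihilator I, convFun μ f = 0) ∧
      ¬ Synthesizable (annihilator I) := by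
  obtain ⟨n, hn⟩ := hD
  have hf : IsGeneralizedPolynomial (n + 1) (generatingFunction D m) :=
    hn.isGeneralizedPolynomial m
  have hp := generatingFunction_notMem_polynomials D hpoly m hm
  have hker := ker_transform_le_orthogonalMeasures D m
  exact ⟨orthogonalIdeal (translationInvariant_translateSpanConst _) m,
    coe_orthogonalIdeal_eq_derivationIdeal D m, isClosed_orthogonalIdeal _ hker,
    nonLocalizable_orthogonalIdeal hf hp hker, isVariety_annihilator _,
    transform_mem_iff_forall_annihilator _ hker, not_synthesizable_annihilator hf hp hker⟩
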